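/- Let $R$ be a finite commutative ring with $1\neq 0$, let $J$ be its Jacobson radical, and write $R=R_1\times\cdots\times R_\ell$ with $R_1,\dots,R_\ell$ finite local rings. Order $\mathbb N^u$ componentwise, with join $\vee$, and let $|s|=s_1+\dots+s_u$ for $s\in\mathbb N^u$. A *support* on $R^n$ is a map $\sigma:R^n\to\mathbb N^u$ such that for all $v,w\in R^n$ and $r\in R$: $\sigma(v)=0$ if and only if $v=0$; $\sigma(rv)\le\sigma(v)$; $\sigma(v+w)\le\sigma(v)\vee\sigma(w)$. It is *modular* if, whenever $v,w\in R^n$ and $i\in\{1,\dots,u\}$ satisfy $0\ne\sigma(v)_i\le\sigma(w)_i$, there is $r\in R$ with $\sigma(v+rw)_i<\sigma(v)_i$. A *code* is an $R$-submodule $C\subseteq R^n$. Let $C_i\subseteq R_i^n$ be the projection of $C$, so that $C=C_1\times\cdots\times C_\ell$, and let $M(C)=\mu(C_1)+\dots+\mu(C_\ell)$, where $\mu$ denotes the least cardinality of a system of generators. The support of a code $D$ is $\sigma(D)=\bigvee_{v\in D}\sigma(v)$. For $1\le r\le M(C)$, the $r$-th *generalized weight* $d_r(C)$ is the minimum of $|\sigma(D)|$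 over the submodules $D\subseteq C$ that have a minimal (with respect to inclusion) system of generators of some cardinality $j\ge r$. Let $K$ be any field, let $S=K[x_1,\dots,x_u]$ with the standard grading, and let $I_C=(x^{\sigma(v)} : v\in C\setminus\{0\})\subseteq S$ (so $I_C=0$ if $C=0$). **Theorem.** Let $\sigma$ be a modular support on $R^n$ and let $C\subseteq R^n$ be a code. Assume that $C\subseteq 0:_{R^n}J=\{v\in R^n : rv=0\text{ for all }r\in J\}$ or that $R$ is a principal ideal ring. Then $M(C)$ is the projective dimension of the $S$-module $S/I_C$. Moreover, $S/I_C$ has a minimal graded free resolution, and for every such resolution $\cdots\to F_1\to F_0\to S/I_C\to 0$ and every $r\in\{1,\dots,M(C)\}$, the weight $d_r(C)$ is the minimum $j$ such that $S(-j)$ is a direct summand in the given decomposition of $F_r$, equivalently the minimum degree of a nonzero homogeneous element of $F_r$. In particular, the graded Betti numbers $\beta_{i,j}$ of $S/I_C$ (the number of summands $S(-j)$ of $F_i$) determine $M(C)$ and the generalized weights of $C$: $M(C)=\max\{i : \beta_{i,j}\ne 0\text{ for some }j\}$, and $d_r(C)=\min\{j : \beta_{r,j}\neq 0\}$ for $1\le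 r\le M(C)$. -/

import Mathlib

namespace ModularCode

noncomputable section

/-- A support on `R^n`: a map `σ : R^n → ℕ^u` such that `σ v = 0` iff `v = 0`, `σ (r v) ≤ σ v`
and `σ (v + w) ≤ σ v ∨ σ w`, for the componentwise order on `ℕ^u`. -/
structure IsSupport {R : Type*} [CommRing R] {n u : ℕ}
    (σ : (Fin n → R) → (Fin u → ℕ)) : Prop where
  eq_zero_iff : ∀ v, σ v = 0 ↔ v = 0
  smul_le : ∀ (r : R) v, σ (r • v) ≤ σ v
  add_le : ∀ v w, σ (v + w) ≤ σ v ⊔ σ w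

/-- A modular support: if `0 ≠ σ(v)_i ≤ σ(w)_i`, then `σ(v + r w)_i < σ(v)_i` for some `r`. -/
structure IsModularSupport {R : Type*} [CommRing R] {n u : ℕ}
    (σ : (Fin n → R) → (Fin u → ℕ)) : Prop extends IsSupport σ where
  modular : ∀ (v w : Fin n → R) (i : Fin u), σ v i ≠ 0 → σ v i ≤ σ w i →
    ∃ r : R, σ (v + r • w) i < σ v i

/-- The `𝔪`-component of a code `C ⊆ R^n`. A finite commutative ring `R` is the product of its
localizations at its maximal ideals, which are finite local rings (the isomorphism is
`MaximalSpectrum.toPiLocalizationEquiv`); the component is the image of `C` under the projection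
`R^n → (R_𝔪)^n`, as an `R_𝔪`-submodule. -/
def component {R : Type*} [CommRing R] {n : ℕ} (C : Submodule R (Fin n → R))
    (𝔪 : MaximalSpectrum R) :
    Submodule (Localization.AtPrime 𝔪.asIdeal) (Fin n → Localization.AtPrime 𝔪.asIdeal) :=
  Submodule.span (Localization.AtPrime 𝔪.asIdeal)
    ((fun (v : Fin n → R) (i : Fin n) =>
      algebraMap R (Localization.AtPrime 𝔪.asIdeal) (v i)) '' (C : Set (Fin n → R)))

/-- `M(C) = μ(C_1) + ... + μ(C_ℓ)`, where `C_1, ..., C_ℓ` are the components of `C` over the local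
factors of `R` and `μ` is the least cardinality of a system of generators. -/
def M {R : Type*} [CommRing R] {n : ℕ} (C : Submodule R (Fin n → R)) : ℕ :=
  ∑ᶠ 𝔪 : MaximalSpectrum R, (component C 𝔪).spanFinrank

/-- `D` has a minimal system of generators (minimal with respect to inclusion) of
cardinality `j`. -/
def HasMinimalGenerators {R : Type*} [CommRing R] {n : ℕ} (D : Submodule R (Fin n → R))
    (j : ℕ) : Prop :=
  ∃ s : Finset (Fin n → R), s.card = j ∧ Submodule.span R (s : Set (Fin n → R)) = D ∧
    ∀ t : Finset (Fin n → R), t ⊂ s → Submodule.span R (t : Set (Fin n → R)) ≠ D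

/-- The support of a code: the join of the supports of its codewords. -/
def codeSupport {R : Type*} [CommRing R] [Finite R] {n u : ℕ}
    (σ : (Fin n → R) → (Fin u → ℕ)) (D : Submodule R (Fin n → R)) : Fin u → ℕ :=
  (Set.toFinite (D : Set (Fin n → R))).toFinset.sup σ

/-- The `r`-th generalized weight `d_r(C)`: the minimum of `|σ(D)|` over the subcodes `D` of `C`
that have a minimal system of generators of some cardinality `j ≥ r`. -/
def generalizedWeight {R : Type*} [CommRing R] [Finite R] {n u : ℕ}
    (σ : (Fin n → R) → (Fin u → ℕ)) (C : Submodule R (Fin n → R)) (r : ℕ) : ℕ :=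
  sInf {w : ℕ | ∃ D : Submodule R (Fin n → R), D ≤ C ∧
    (∃ j, r ≤ j ∧ HasMinimalGenerators D j) ∧ w = ∑ i, codeSupport σ D i}

/-- The monomial ideal `I_C ⊆ K[x_1, ..., x_u]` generated by the monomials `x^{σ(v)}`, for `v` a
nonzero codeword of `C`. -/
def codeIdeal (K : Type*) [Field K] {R : Type*} [CommRing R] {n u : ℕ}
    (σ : (Fin n → R) → (Fin u → ℕ)) (C : Submodule R (Fin n → R)) :
    Ideal (MvPolynomial (Fin u) K) :=
  Ideal.span {m | ∃ v ∈ C, v ≠ 0 ∧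
    m = MvPolynomial.monomial (Finsupp.equivFunOnFinite.symm (σ v)) (1 : K)}

/-- `x` is homogeneous of degree `t` in the graded free module `⨁ k, S(-a k)`, whose `k`-th basis
vector has degree `a k`, for the standard grading of `S = K[x_1, ..., x_u]`. -/
def IsHomogeneousVec {K : Type*} [Field K] {u b : ℕ} (a : Fin b → ℤ) (t : ℤ)
    (x : Fin b → MvPolynomial (Fin u) K) : Prop :=
  ∀ k, ∀ c ∈ (x k).support, (c.degree : ℤ) + a k = t

/-- A minimal graded free resolution
`... → F_2 → F_1 → F_0 → S/I → 0` of `S/I`, where `S = K[x_1, ..., x_u]` has the standard grading: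
`F_i = ⨁ k, S(-shift i k)` is a finitely generated graded free module, all maps are graded of
degree `0`, the sequence is exact, and `d i (F_{i+1}) ⊆ (x_1, ..., x_u) F_i` for all `i`. -/
structure MinimalGradedFreeResolution {K : Type*} [Field K] {u : ℕ}
    (I : Ideal (MvPolynomial (Fin u) K)) where
  rank : ℕ → ℕ
  shift : (i : ℕ) → Fin (rank i) → ℤ
  ε : (Fin (rank 0) → MvPolynomial (Fin u) K) →ₗ[MvPolynomial (Fin u) K]
    (MvPolynomial (Fin u) K ⧸ I)
  d : (i : ℕ) → (Fin (rank (i + 1)) → MvPolynomial (Fin u) K) →ₗ[MvPolynomial (Fin u) K]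
    (Fin (rank i) → MvPolynomial (Fin u) K)
  ε_graded : ∀ k, ∃ f : MvPolynomial (Fin u) K,
    (∀ c ∈ f.support, (c.degree : ℤ) = shift 0 k) ∧ ε (Pi.single k 1) = Ideal.Quotient.mk I f
  d_graded : ∀ i k, IsHomogeneousVec (shift i) (shift (i + 1) k) (d i (Pi.single k 1))
  ε_surjective : Function.Surjective ε
  exact_zero : Function.Exact (d 0) ε
  exact_succ : ∀ i, Function.Exact (d (i + 1)) (d i)
  minimal : ∀ i x k, d i x k ∈
    Ideal.span (Set.range (MvPolynomial.X : Fin u → MvPolynomial (Fin u) K))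

/-- The graded Betti number `β_{i,j}`: the number of summands `S(-j)` of `F_i`. -/
def MinimalGradedFreeResolution.betti {K : Type*} [Field K] {u : ℕ}
    {I : Ideal (MvPolynomial (Fin u) K)} (F : MinimalGradedFreeResolution I) (i : ℕ) (j : ℤ) : ℕ :=
  (Finset.univ.filter fun k => F.shift i k = j).card

end

end ModularCode

/-! ### Acyclic complexes of vector spaces on cogeometric posets -/

namespace ModularCode

noncomputable section

/-! The ideal only sees the socle of `C`, the codewords killed by the Jacobson radical `J`: every
nonzero codeword has a nonzero multiple there, whose support is no larger. Hence `x^a` lies in `I_C`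
iff the flat `V_a = {v in the socle : σ v ≤ a}` is nonzero. On the socle a modular support takes at
most one nonzero value at each coordinate (`IsModularSupport.eq_of_mem_socle`). So the elements
vanishing at coordinate `i` form a hyperplane, in the sense that it cuts every flat not contained in
it in a maximal submodule. The flats therefore behave like intersections in a hyperplane
arrangement: ranked by length, their lower intervals are dual to geometric lattices
(`Flat.isCogeometricRank`).

On such a poset a complex of vector spaces is built rank by rank, adding in rank `r + 1` a basis of
the `r`-cycles below each `D` of rank `r + 1`. A Mayer-Vietoris induction (`acyclicBelowCoatoms`)
shows that the part below any `V ≠ ⊥` is exact (`exact_below`), and thickness of intervals of length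
two shows that every `D` contributes (`exists_label_eq`). Give the basis vectors labelled by `D` the
multidegree `σ(D)` and homogenize: in multidegree `a` the result is the part below `V_a`, so it
resolves `S/I_C`. It is minimal because multidegrees strictly increase along nonzero entries. Its
shifts in degree `r` are exactly the numbers `|σ(D)|` for flats `D` of rank `r`. By graded Nakayama
every minimal graded resolution has the same shifts, and the last nonzero term gives the projective
dimension.

It remains to match the numerical invariants. `M(C)` is the length of `C/JC`, and an irredundant
generating system of `D` has at most `length (D/JD)` elements. Under either hypothesis on `C` this
length equals that of the socle of `D` (`length_quotient_jacobson_eq`). Thus `M(C)` is the rank of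
the largest flat, and the minimum defining `d_r(C)` is attained on the flats of rank `r`. -/

/-- A rank function on a meet semilattice whose lower intervals are dual to geometric lattices, in
the form in which this is used: every proper element of a lower interval is below a coatom, two
distinct coatoms meet in a coatom of each of them, and intervals of length two are thick. -/
structure IsCogeometricRank {L : Type*} [SemilatticeInf L] [OrderBot L] (rk : L → ℕ) : Prop where
  bot : rk ⊥ = 0
  strictMono : StrictMono rk
  exists_coatom : ∀ D V, D < V → ∃ X, D ≤ X ∧ X ≤ V ∧ rk X + 1 = rk V
  inf_coatom : ∀ V X Y, X ≤ V → Y ≤ V → rk X + 1 = rk V → rk Y + 1 = rk V → X ≠ Y →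
    rk (X ⊓ Y) + 1 = rk X
  thick : ∀ V X Z, X ≤ V → rk X + 1 = rk V → Z ≤ X → rk Z + 1 = rk X →
    ∃ Y, Y ≤ V ∧ rk Y + 1 = rk V ∧ Y ≠ X ∧ Z ≤ Y

universe v w

/-- Two consecutive terms, with chosen labelled bases, and the differential between them, of a
complex of vector spaces. -/
structure LabelledStage (K : Type w) [Field K] (L : Type v) where
  basis : Type v
  target : Type v
  finite_basis : Finite basis
  label : basis → L
  diff : (basis →₀ K) →ₗ[K] (target →₀ K)

attribute [instance] LabelledStage.finite_basis

section

variable {K : Type w} [Field K] {L : Type v}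

/-- The chains of a stage with labels in `P`. -/
def LabelledStage.chains (s : LabelledStage K L) (P : Set L) : Submodule K (s.basis →₀ K) :=
  Finsupp.supported K K {b | s.label b ∈ P}

theorem LabelledStage.chains_mono (s : LabelledStage K L) {P Q : Set L} (h : P ⊆ Q) :
    s.chains P ≤ s.chains Q :=
  Finsupp.supported_mono fun _ hb => h hb

theorem LabelledStage.chains_union (s : LabelledStage K L) (P Q : Set L) :
    s.chains (P ∪ Q) = s.chains P ⊔ s.chains Q :=
  Finsupp.supported_union _ _

theorem LabelledStage.chains_inter (s : LabelledStage K L) (P Q : Set L) :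
    s.chains (P ∩ Q) = s.chains P ⊓ s.chains Q :=
  Finsupp.supported_inter _ _

theorem LabelledStage.chains_congr (s : LabelledStage K L) {P Q : Set L}
    (h : ∀ b, s.label b ∈ P → s.label b ∈ Q) : s.chains P ≤ s.chains Q :=
  Finsupp.supported_mono fun b hb => h b hb

theorem LabelledStage.chains_eq_bot (s : LabelledStage K L) {P : Set L}
    (h : ∀ b, s.label b ∉ P) : s.chains P = ⊥ := by
  have : {b | s.label b ∈ P} = ∅ := by ext b; simpa using h b
  rw [LabelledStage.chains, this, Finsupp.supported_empty]

variable [SemilatticeInf L] [OrderBot L]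

/-- The cycles of a stage with labels below `D`. -/
def LabelledStage.cycles (s : LabelledStage K L) (D : L) : Submodule K (s.basis →₀ K) :=
  s.chains (Set.Iic D) ⊓ LinearMap.ker s.diff

instance (s : LabelledStage K L) (D : L) : Module.Free K (s.cycles D) :=
  Module.Free.of_divisionRing K (s.cycles D)

/-- The next stage: for each `D` of rank `r`, kill the cycles with labels below `D`. -/
def LabelledStage.next [Finite L] (rk : L → ℕ) (r : ℕ) (s : LabelledStage K L) :
    LabelledStage K L where
  basis := Σ D : {D : L // rk D = r}, Fin (Module.finrank K (s.cycles D))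
  target := s.basis
  finite_basis := inferInstance
  label := fun b => b.1
  diff := Finsupp.linearCombination K fun b =>
    (Module.finBasis K (s.cycles b.1) b.2 : s.basis →₀ K)

/-- The complex of vector spaces attached to a ranked poset; its term in degree `r` is the sum, over
the elements `D` of rank `r`, of the reduced homology of the open interval from `⊥` to `D`. -/
def homologyComplex (K : Type w) [Field K] [Finite L] (rk : L → ℕ) : ℕ → LabelledStage K L
  | 0 => ⟨PUnit, PEmpty, inferInstance, fun _ => ⊥, 0⟩
  | r + 1 => (homologyComplex K rk r).next rk (r + 1)

variable [Finite L] {rk : L → ℕ}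

theorem rank_label (hrk : rk ⊥ = 0) (r : ℕ) (b : (homologyComplex K rk r).basis) :
    rk ((homologyComplex K rk r).label b) = r := by
  cases r with
  | zero => exact hrk
  | succ r => exact b.1.2

/-- The differential of the complex, between consecutive terms. -/
def boundary (K : Type w) [Field K] (rk : L → ℕ) (r : ℕ) :
    ((homologyComplex K rk (r + 1)).basis →₀ K) →ₗ[K] ((homologyComplex K rk r).basis →₀ K) :=
  (homologyComplex K rk (r + 1)).diff

/-- The basis element of degree `r + 1` given by a basis vector of the cycles below `D`. -/
def basisElt (r : ℕ) {D : L} (hD : rk D = r + 1)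
    (i : Fin (Module.finrank K ((homologyComplex K rk r).cycles D))) :
    (homologyComplex K rk (r + 1)).basis :=
  ⟨⟨D, hD⟩, i⟩

theorem label_basisElt (r : ℕ) {D : L} (hD : rk D = r + 1)
    (i : Fin (Module.finrank K ((homologyComplex K rk r).cycles D))) :
    (homologyComplex K rk (r + 1)).label (basisElt r hD i) = D :=
  rfl

theorem basisElt_injective (r : ℕ) {D : L} (hD : rk D = r + 1) :
    Function.Injective (basisElt (K := K) r hD) :=
  fun _ _ h => eq_of_heq (Sigma.mk.inj h).2

theorem exists_basisElt_eq (r : ℕ) (b : (homologyComplex K rk (r + 1)).basis) :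
    ∃ (D : L) (hD : rk D = r + 1) (i : _), basisElt (K := K) r hD i = b :=
  ⟨b.1.1, b.1.2, b.2, rfl⟩

theorem boundary_basisElt (r : ℕ) {D : L} (hD : rk D = r + 1)
    (i : Fin (Module.finrank K ((homologyComplex K rk r).cycles D))) :
    boundary K rk r (Finsupp.single (basisElt r hD i) 1) =
      (Module.finBasis K ((homologyComplex K rk r).cycles D) i :
        (homologyComplex K rk r).basis →₀ K) :=
  (Finsupp.linearCombination_single K _ _).trans (one_smul K _)

/-- A basis element of degree `r + 1` maps to a cycle below its label. -/
theorem boundary_single_mem (r : ℕ) (b : (homologyComplex K rk (r + 1)).basis) :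
    boundary K rk r (Finsupp.single b 1) ∈
      (homologyComplex K rk r).cycles ((homologyComplex K rk (r + 1)).label b) := by
  obtain ⟨D, hD, i, rfl⟩ := exists_basisElt_eq r b
  rw [boundary_basisElt, label_basisElt]
  exact Subtype.property _

theorem diff_boundary (r : ℕ) (x) : (homologyComplex K rk r).diff (boundary K rk r x) = 0 := by
  induction x using Finsupp.induction_linear with
  | zero => simp
  | add x y hx hy => simp [hx, hy]
  | single b c =>
    rw [← mul_one c, ← smul_eq_mul, ← Finsupp.smul_single, map_smul, map_smul,
      LinearMap.mem_ker.1 (boundary_single_mem r b).2, smul_zero]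

theorem boundary_mem_chains (r : ℕ) {P : Set L} (hP : IsLowerSet P) {x}
    (hx : x ∈ (homologyComplex K rk (r + 1)).chains P) :
    boundary K rk r x ∈ (homologyComplex K rk r).chains P := by
  rw [LabelledStage.chains, Finsupp.supported_eq_span_single] at hx
  refine Submodule.span_induction ?_ (by simp) (fun x y _ _ hx hy => by
    rw [map_add]; exact add_mem hx hy) (fun c x _ hx => by
    rw [map_smul]; exact Submodule.smul_mem _ _ hx) hx
  rintro _ ⟨b, hb, rfl⟩
  exact LabelledStage.chains_mono _ (fun D hD => hP hD hb) (boundary_single_mem r b).1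

/-- A cycle below an element of the next rank is a boundary. -/
theorem exists_boundary_eq_of_mem_cycles {r : ℕ} {D : L} (hD : rk D = r + 1) {z}
    (hz : z ∈ (homologyComplex K rk r).cycles D) :
    ∃ y ∈ (homologyComplex K rk (r + 1)).chains (Set.Iic D), boundary K rk r y = z := by
  let e := Module.finBasis K ((homologyComplex K rk r).cycles D)
  refine ⟨∑ i, e.repr ⟨z, hz⟩ i • Finsupp.single (basisElt r hD i) (1 : K), ?_, ?_⟩
  · refine Submodule.sum_mem _ fun i _ => Submodule.smul_mem _ _ ?_
    exact Finsupp.single_mem_supported _ _ (le_refl D)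
  · rw [map_sum]
    simp only [map_smul, boundary_basisElt]
    rw [← Submodule.coe_subtype]
    simp only [← map_smul, ← map_sum]
    rw [e.sum_repr]
    rfl

theorem boundary_mapDomain_basisElt (r : ℕ) {D : L} (hD : rk D = r + 1)
    (x : Fin (Module.finrank K ((homologyComplex K rk r).cycles D)) →₀ K) :
    boundary K rk r (Finsupp.mapDomain (basisElt r hD) x) =
      Finsupp.linearCombination K (fun i =>
        (Module.finBasis K ((homologyComplex K rk r).cycles D) i :
          (homologyComplex K rk r).basis →₀ K)) x := by
  induction x using Finsupp.induction_linear with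
  | zero => simp
  | add x y hx hy => rw [Finsupp.mapDomain_add, map_add, map_add, hx, hy]
  | single i c =>
    rw [Finsupp.mapDomain_single, Finsupp.linearCombination_single, ← boundary_basisElt r hD,
      ← map_smul, Finsupp.smul_single, smul_eq_mul, mul_one]

theorem exists_mapDomain_basisElt_eq {r : ℕ} {D : L} (hD : rk D = r + 1)
    {y : (homologyComplex K rk (r + 1)).basis →₀ K}
    (hy : y ∈ (homologyComplex K rk (r + 1)).chains {D}) :
    ∃ x, Finsupp.mapDomain (basisElt r hD) x = y := by
  refine ⟨_, Finsupp.mapDomain_comapDomain (basisElt r hD) (basisElt_injective r hD) y ?_⟩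
  intro b hb
  have hb' := (Finsupp.mem_supported _ _).1 hy hb
  obtain ⟨D', hD', i, rfl⟩ := exists_basisElt_eq r b
  obtain rfl : D' = D := hb'
  exact ⟨i, rfl⟩

theorem eq_zero_of_linearCombination_coe_basis {k V ι : Type*} [Semiring k] [AddCommMonoid V]
    [Module k V] {Z : Submodule k V} (e : Module.Basis ι k Z) (x : ι →₀ k)
    (h : Finsupp.linearCombination k (fun i => (e i : V)) x = 0) : x = 0 := by
  have h2 : ((e.repr.symm x : Z) : V) = 0 := by
    rw [← h, Module.Basis.repr_symm_apply]
    exact Finsupp.apply_linearCombination k Z.subtype e x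
  exact e.repr.symm.map_eq_zero_iff.1 (Subtype.ext h2)

/-- The differential is injective on the chains with a given label of the right rank. -/
theorem eq_zero_of_boundary_eq_zero {r : ℕ} {D : L}
    {y : (homologyComplex K rk (r + 1)).basis →₀ K}
    (hy : y ∈ (homologyComplex K rk (r + 1)).chains {D}) (h : boundary K rk r y = 0) : y = 0 := by
  by_cases hD : rk D = r + 1
  · obtain ⟨x, rfl⟩ := exists_mapDomain_basisElt_eq hD hy
    rw [boundary_mapDomain_basisElt] at h
    rw [eq_zero_of_linearCombination_coe_basis _ x h, Finsupp.mapDomain_zero]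
  · rw [LabelledStage.chains_eq_bot] at hy
    · exact (Submodule.mem_bot K).1 hy
    · rintro b hb
      obtain ⟨D', hD', i, rfl⟩ := exists_basisElt_eq r b
      obtain rfl : D' = D := hb
      exact hD hD'

/-- The elements below some member of `S`. -/
theorem isLowerSet_below {L : Type*} [Preorder L] (S : Set L) :
    IsLowerSet {D : L | ∃ X ∈ S, D ≤ X} :=
  fun _ _ hab ⟨X, hX, h⟩ => ⟨X, hX, hab.trans h⟩

/-- Acyclicity in low degrees of the part of the complex below a set of coatoms of `V`. -/
def AcyclicBelowCoatoms (K : Type w) [Field K] (rk : L → ℕ) (V : L) : Prop :=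
  ∀ S : Finset L, S.Nonempty → (∀ X ∈ S, X ≤ V ∧ rk X + 1 = rk V) → ∀ r, r + 1 < rk V →
    ∀ z ∈ (homologyComplex K rk r).chains {D | ∃ X ∈ S, D ≤ X},
      (homologyComplex K rk r).diff z = 0 →
      ∃ y ∈ (homologyComplex K rk (r + 1)).chains {D | ∃ X ∈ S, D ≤ X}, boundary K rk r y = z

/-- If `r + 1 = rk V`, cycles below `V` bound by construction of the next term. If `r + 1 < rk V`,
no label of rank `r` equals `V`, so each lies below a coatom and acyclicity applies to the set of
all coatoms. -/
theorem AcyclicBelowCoatoms.exact_Iic (hrk : IsCogeometricRank rk) {V : L}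
    (hV : AcyclicBelowCoatoms K rk V) {r : ℕ} (hr : r < rk V) {z}
    (hz : z ∈ (homologyComplex K rk r).chains (Set.Iic V))
    (hz0 : (homologyComplex K rk r).diff z = 0) :
    ∃ y ∈ (homologyComplex K rk (r + 1)).chains (Set.Iic V), boundary K rk r y = z := by
  classical
  have := Fintype.ofFinite L
  rcases (Nat.succ_le_of_lt hr).eq_or_lt with h | h
  · exact exists_boundary_eq_of_mem_cycles h.symm ⟨hz, hz0⟩
  · let S : Finset L := Finset.univ.filter fun X => X ≤ V ∧ rk X + 1 = rk V
    have hS : ∀ D, D < V → ∃ X ∈ S, D ≤ X := fun D hD => by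
      obtain ⟨X, h1, h2, h3⟩ := hrk.exists_coatom D V hD
      exact ⟨X, by simp [S, h2, h3], h1⟩
    have hne : S.Nonempty := by
      have hb : (⊥ : L) < V := by
        refine bot_lt_iff_ne_bot.2 fun h0 => ?_
        rw [h0, hrk.bot] at hr
        omega
      obtain ⟨X, hX, -⟩ := hS ⊥ hb
      exact ⟨X, hX⟩
    obtain ⟨y, hy, hyz⟩ := hV S hne (fun X hX => by simpa [S] using hX) r h z
      (LabelledStage.chains_congr _ (fun b hb => hS _ (lt_of_le_of_ne hb fun hbV => by
        have := rank_label hrk.bot r b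
        rw [hbV] at this
        omega)) hz) hz0
    refine ⟨y, LabelledStage.chains_mono _ ?_ hy, hyz⟩
    rintro D ⟨X, hX, hDX⟩
    exact hDX.trans (by simpa [S] using hX : X ≤ V ∧ _).1

/-- Mayer-Vietoris, by induction on the rank of `V` and then on the set of coatoms. When `X` is
added to `S`, the two parts overlap in what lies below the meets `X ⊓ Y`, `Y ∈ S`. These are coatoms
of `X`, so the induction on the rank covers the overlap. -/
theorem acyclicBelowCoatoms (hrk : IsCogeometricRank rk) (V : L) :
    AcyclicBelowCoatoms K rk V := by
  classical
  induction hm : rk V using Nat.strong_induction_on generalizing V with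
  | _ m ih =>
  subst hm
  intro S
  induction S using Finset.induction_on with
  | empty => intro h; exact absurd h (by simp)
  | insert X S hXS ihS =>
    intro _ hcoat r hr z hz hz0
    obtain ⟨hXV, hXr⟩ := hcoat X (Finset.mem_insert_self _ _)
    have hcoat' : ∀ Y ∈ S, Y ≤ V ∧ rk Y + 1 = rk V :=
      fun Y hY => hcoat Y (Finset.mem_insert_of_mem hY)
    have hX := ih (rk X) (by omega) X rfl
    have hset : {D : L | ∃ Y ∈ insert X S, D ≤ Y} = Set.Iic X ∪ {D | ∃ Y ∈ S, D ≤ Y} := by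
      ext D; simp
    rw [hset] at hz ⊢
    rw [LabelledStage.chains_union] at hz
    obtain ⟨y, hy, z', hz', rfl⟩ := Submodule.mem_sup.1 hz
    rcases S.eq_empty_or_nonempty with rfl | hne
    · have : z' = 0 := by
        rw [LabelledStage.chains_eq_bot _ (by simp)] at hz'
        exact hz'
      subst this
      rw [add_zero] at hz0 ⊢
      obtain ⟨q, hq, hqy⟩ := hX.exact_Iic hrk (r := r) (by omega) hy hz0
      exact ⟨q, LabelledStage.chains_mono _ Set.subset_union_left hq, hqy⟩
    -- The boundary of `y` is minus that of `z'`, so it lives on the overlap and bounds a chain `x`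
    -- there. Then `y - x` and `z' + x` are cycles below `X` and below `S` respectively.
    obtain ⟨x, hx1, hx2, hxy⟩ : ∃ x ∈ (homologyComplex K rk r).chains (Set.Iic X),
        x ∈ (homologyComplex K rk r).chains {D | ∃ Y ∈ S, D ≤ Y} ∧
        (homologyComplex K rk r).diff x = (homologyComplex K rk r).diff y := by
      cases r with
      | zero => exact ⟨0, zero_mem _, zero_mem _, rfl⟩
      | succ r =>
        have h1 : boundary K rk r y ∈ (homologyComplex K rk r).chains (Set.Iic X) :=
          boundary_mem_chains r (isLowerSet_Iic X) hy
        have h2 : boundary K rk r y ∈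
            (homologyComplex K rk r).chains {D | ∃ Y ∈ S, D ≤ Y} := by
          have : boundary K rk r y = -boundary K rk r z' := by
            rw [map_add] at hz0
            exact eq_neg_of_add_eq_zero_left hz0
          rw [this]
          exact neg_mem (boundary_mem_chains r (isLowerSet_below (S : Set L)) hz')
        have h3 : boundary K rk r y ∈
            (homologyComplex K rk r).chains {D | ∃ Y ∈ S.image (X ⊓ ·), D ≤ Y} := by
          have := Submodule.mem_inf.2 ⟨h1, h2⟩
          rw [← LabelledStage.chains_inter] at this
          refine LabelledStage.chains_mono _ ?_ this
          rintro D ⟨hD, Y, hY, hDY⟩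
          exact ⟨X ⊓ Y, Finset.mem_image_of_mem _ hY, le_inf hD hDY⟩
        obtain ⟨x, hx, hxy⟩ := hX (S.image (X ⊓ ·)) (hne.image _) (by
          intro T hT
          obtain ⟨Y, hY, rfl⟩ := Finset.mem_image.1 hT
          exact ⟨inf_le_left, hrk.inf_coatom V X Y hXV (hcoat' Y hY).1 hXr (hcoat' Y hY).2
            (fun h => hXS (h ▸ hY))⟩) r (by omega) _ h3 (diff_boundary r y)
        refine ⟨x, LabelledStage.chains_mono _ ?_ hx, LabelledStage.chains_mono _ ?_ hx, hxy⟩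
        · rintro D ⟨T, hT, hDT⟩
          obtain ⟨Y, hY, rfl⟩ := Finset.mem_image.1 hT
          exact hDT.trans inf_le_left
        · rintro D ⟨T, hT, hDT⟩
          obtain ⟨Y, hY, rfl⟩ := Finset.mem_image.1 hT
          exact ⟨Y, hY, hDT.trans inf_le_right⟩
    obtain ⟨q, hq, hqy⟩ := hX.exact_Iic hrk (r := r) (by omega) (sub_mem hy hx1)
      (by rw [map_sub, hxy, sub_self])
    obtain ⟨q', hq', hqz⟩ := ihS hne hcoat' r hr (z' + x) (add_mem hz' hx2) (by
      rw [map_add, hxy, add_comm, ← map_add, hz0])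
    refine ⟨q + q', add_mem (LabelledStage.chains_mono _ Set.subset_union_left hq)
      (LabelledStage.chains_mono _ Set.subset_union_right hq'), ?_⟩
    rw [map_add, hqy, hqz]
    abel

/-- The part of the complex below `V ≠ ⊥` is exact. -/
theorem exact_below (hrk : IsCogeometricRank rk) {V : L} (hV : V ≠ ⊥) {r : ℕ} {z}
    (hz : z ∈ (homologyComplex K rk r).chains (Set.Iic V))
    (hz0 : (homologyComplex K rk r).diff z = 0) :
    ∃ y ∈ (homologyComplex K rk (r + 1)).chains (Set.Iic V), boundary K rk r y = z := by
  rcases lt_or_ge r (rk V) with h | h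
  · exact (acyclicBelowCoatoms hrk V).exact_Iic hrk h hz hz0
  -- In degrees at least `rk V` the only possible label below `V` is `V` itself. There the
  -- differential is injective, so the cycle vanishes.
  · have hpos : 0 < rk V := hrk.bot ▸ hrk.strictMono (bot_lt_iff_ne_bot.2 hV)
    obtain ⟨r, rfl⟩ : ∃ k, r = k + 1 := ⟨r - 1, by omega⟩
    refine ⟨0, zero_mem _, ?_⟩
    rw [map_zero]
    refine (eq_zero_of_boundary_eq_zero (D := V) (LabelledStage.chains_congr _ ?_ hz) hz0).symm
    intro b hb
    refine (lt_or_eq_of_le hb).resolve_left fun hlt => ?_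
    have := hrk.strictMono hlt
    rw [rank_label hrk.bot] at this
    omega

/-- Every element of rank `r` is the label of a basis element in degree `r`. -/
theorem exists_label_eq (hrk : IsCogeometricRank rk) (r : ℕ) (D : L) (hD : rk D = r) :
    ∃ b : (homologyComplex K rk r).basis, (homologyComplex K rk r).label b = D := by
  classical
  have := Fintype.ofFinite L
  induction r generalizing D with
  | zero =>
    refine ⟨PUnit.unit, ?_⟩
    change ⊥ = D
    by_contra h
    have := hrk.strictMono (bot_lt_iff_ne_bot.2 (Ne.symm h))
    omega
  | succ r ih =>
    suffices h : ∃ z ∈ (homologyComplex K rk r).cycles D, z ≠ 0 by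
      obtain ⟨z, hz, hz0⟩ := h
      refine ⟨basisElt r hD ⟨0, Nat.pos_of_ne_zero fun h => hz0 ?_⟩, rfl⟩
      have he := (Module.finBasis K ((homologyComplex K rk r).cycles D)).sum_repr ⟨z, hz⟩
      have : IsEmpty (Fin (Module.finrank K ((homologyComplex K rk r).cycles D))) := by
        rw [h]; infer_instance
      rw [Finset.univ_eq_empty, Finset.sum_empty] at he
      exact (congrArg Subtype.val he).symm
    obtain ⟨X, -, hXD, hXr⟩ := hrk.exists_coatom ⊥ D (bot_lt_iff_ne_bot.2 (by
      rintro rfl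
      rw [hrk.bot] at hD
      omega))
    obtain ⟨b, hb⟩ := ih X (by omega)
    -- A nonzero cycle below `D` is sought in the form `b - x`, with `b` labelled by the coatom `X`
    -- and `x` supported below the other coatoms.
    let S : Finset L := Finset.univ.filter fun Y => Y ≤ D ∧ rk Y + 1 = rk D ∧ Y ≠ X
    have hS : ∀ Y ∈ S, Y ≤ D ∧ rk Y + 1 = rk D ∧ Y ≠ X := fun Y hY => by simpa [S] using hY
    obtain ⟨x, hx, hxb⟩ : ∃ x ∈ (homologyComplex K rk r).chains {D | ∃ Y ∈ S, D ≤ Y},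
        (homologyComplex K rk r).diff x =
          (homologyComplex K rk r).diff (Finsupp.single b 1) := by
      cases r with
      | zero => exact ⟨0, zero_mem _, rfl⟩
      | succ r =>
        obtain ⟨Z, -, hZX, hZr⟩ := hrk.exists_coatom ⊥ X (bot_lt_iff_ne_bot.2 (by
          rintro rfl
          rw [hrk.bot] at hXr
          omega))
        have hne : S.Nonempty := by
          obtain ⟨Y, h1, h2, h3, -⟩ := hrk.thick D X Z hXD hXr hZX hZr
          exact ⟨Y, by simp [S, h1, h2, h3]⟩
        obtain ⟨h1, h2⟩ := boundary_single_mem (K := K) (rk := rk) r b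
        refine acyclicBelowCoatoms hrk D S hne (fun Y hY => ⟨(hS Y hY).1, (hS Y hY).2.1⟩) r
          (by omega) _ (LabelledStage.chains_congr _ ?_ h1) h2
        -- The boundary of `b` is supported strictly below `X`. Each label there is below a coatom
        -- `Z` of `X`, and thickness puts `Z` below a coatom of `D` other than `X`.
        intro c hc
        rw [hb] at hc
        obtain ⟨Z, hcZ, hZX, hZr⟩ := hrk.exists_coatom _ X (lt_of_le_of_ne hc (by
          intro h
          have := rank_label (K := K) hrk.bot r c
          rw [h] at this
          omega))
        obtain ⟨Y, h1, h2, h3, h4⟩ := hrk.thick D X Z hXD hXr hZX hZr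
        exact ⟨Y, by simp [S, h1, h2, h3], hcZ.trans h4⟩
    refine ⟨Finsupp.single b 1 - x, ⟨sub_mem ?_ ?_, ?_⟩, ?_⟩
    · exact Finsupp.single_mem_supported _ _ (by rw [Set.mem_ofPred_eq, hb]; exact hXD)
    · exact LabelledStage.chains_mono _ (by rintro E ⟨Y, hY, hE⟩; exact hE.trans (hS Y hY).1) hx
    · exact LinearMap.sub_mem_ker_iff.2 hxb.symm
    -- If `b = x`, then `X` lies below a different coatom of the same rank, which strict
    -- monotonicity forbids.
    · intro h
      rw [← sub_eq_zero.1 h] at hx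
      have hbS := (Finsupp.mem_supported _ _).1 hx
        (show b ∈ ((Finsupp.single b (1 : K)).support : Set _) by simp)
      obtain ⟨Y, hY, hbY⟩ := hbS
      rw [hb] at hbY
      obtain ⟨h1, h2, h3⟩ := hS Y hY
      have := hrk.strictMono (lt_of_le_of_ne hbY (Ne.symm h3))
      omega

end

end

end ModularCode

/-! ### Homogenization: from exact complexes of vector spaces to minimal resolutions -/

namespace ModularCode

noncomputable section

open MvPolynomial

section Homogenization

variable {K : Type*} [Field K] {u : ℕ} {ι κ : Type*}

/-- The component in multidegree `a` of an element of the free module whose `k`-th basis vector has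
multidegree `δ k`. -/
def multiComponent (δ : ι → Fin u →₀ ℕ) (x : ι → MvPolynomial (Fin u) K) (a : Fin u →₀ ℕ) (k : ι) :
    K :=
  open Classical in if δ k ≤ a then coeff (a - δ k) (x k) else 0

theorem multiComponent_of_le {δ : ι → Fin u →₀ ℕ} {x : ι → MvPolynomial (Fin u) K}
    {a : Fin u →₀ ℕ} {k : ι} (h : δ k ≤ a) : multiComponent δ x a k = coeff (a - δ k) (x k) :=
  if_pos h

theorem multiComponent_of_not_le {δ : ι → Fin u →₀ ℕ} {x : ι → MvPolynomial (Fin u) K}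
    {a : Fin u →₀ ℕ} {k : ι} (h : ¬ δ k ≤ a) : multiComponent δ x a k = 0 :=
  if_neg h

theorem le_of_multiComponent_ne_zero {δ : ι → Fin u →₀ ℕ} {x : ι → MvPolynomial (Fin u) K}
    {a : Fin u →₀ ℕ} {k : ι} (h : multiComponent δ x a k ≠ 0) : δ k ≤ a := by
  by_contra h'
  exact h (multiComponent_of_not_le h')

theorem multiComponent_ext {δ : ι → Fin u →₀ ℕ} {x y : ι → MvPolynomial (Fin u) K}
    (h : ∀ a k, multiComponent δ x a k = multiComponent δ y a k) : x = y := by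
  funext k
  ext c
  have := h (c + δ k) k
  rwa [multiComponent_of_le le_add_self, multiComponent_of_le le_add_self, add_tsub_cancel_right]
    at this

theorem multiComponent_zero (δ : ι → Fin u →₀ ℕ) (a : Fin u →₀ ℕ) (k : ι) :
    multiComponent δ (0 : ι → MvPolynomial (Fin u) K) a k = 0 := by
  by_cases h : δ k ≤ a
  · simp [multiComponent_of_le h]
  · exact multiComponent_of_not_le h

/-- Finitely many homogeneous components can be prescribed. -/
theorem exists_multiComponent_eq (δ : ι → Fin u →₀ ℕ) (T : Finset (Fin u →₀ ℕ))
    (w : (Fin u →₀ ℕ) → ι → K) (hT : ∀ a ∉ T, w a = 0) (hw : ∀ a k, w a k ≠ 0 → δ k ≤ a) :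
    ∃ x : ι → MvPolynomial (Fin u) K, ∀ a, multiComponent δ x a = w a := by
  classical
  refine ⟨fun k => ∑ a ∈ T, monomial (a - δ k) (w a k), fun a => funext fun k => ?_⟩
  by_cases h : δ k ≤ a
  · rw [multiComponent_of_le h, coeff_sum]
    by_cases ha : a ∈ T
    · rw [Finset.sum_eq_single_of_mem a ha, coeff_monomial, if_pos rfl]
      intro a' _ hne
      rw [coeff_monomial]
      split_ifs with h'
      · by_contra h0
        exact hne (tsub_left_inj (hw a' k h0) h |>.1 h')
      · rfl
    · rw [hT a ha]
      refine Finset.sum_eq_zero fun a' ha' => ?_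
      rw [coeff_monomial]
      split_ifs with h'
      · by_contra h0
        exact ha ((tsub_left_inj (hw a' k h0) h |>.1 h') ▸ ha')
      · rfl
  · rw [multiComponent_of_not_le h]
    by_contra h0
    exact h (hw a k (Ne.symm h0))

/-- Only finitely many multidegrees carry a nonzero component. -/
theorem exists_finset_multiComponent [Fintype ι] (δ : ι → Fin u →₀ ℕ)
    (x : ι → MvPolynomial (Fin u) K) :
    ∃ T : Finset (Fin u →₀ ℕ), ∀ a ∉ T, multiComponent δ x a = 0 := by
  classical
  refine ⟨Finset.univ.biUnion fun k => (x k).support.image (· + δ k), fun a ha => ?_⟩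
  funext k
  by_contra h0
  have h := le_of_multiComponent_ne_zero h0
  refine ha (Finset.mem_biUnion.2 ⟨k, Finset.mem_univ _, Finset.mem_image.2 ⟨a - δ k, ?_, ?_⟩⟩)
  · rw [multiComponent_of_le h] at h0
    exact mem_support_iff.2 h0
  · exact tsub_add_cancel_of_le h

variable [Fintype κ]

/-- The homogenization of a matrix of scalars between based spaces whose basis vectors have
multidegrees `δ'` and `δ`. -/
def homogenization (m : κ → ι → K) (δ' : κ → Fin u →₀ ℕ) (δ : ι → Fin u →₀ ℕ) :
    (κ → MvPolynomial (Fin u) K) →ₗ[MvPolynomial (Fin u) K] (ι → MvPolynomial (Fin u) K) :=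
  Fintype.linearCombination (MvPolynomial (Fin u) K) fun k l => monomial (δ' k - δ l) (m k l)

theorem homogenization_apply (m : κ → ι → K) (δ' : κ → Fin u →₀ ℕ) (δ : ι → Fin u →₀ ℕ) (x) (l) :
    homogenization m δ' δ x l = ∑ k, x k * monomial (δ' k - δ l) (m k l) := by
  simp [homogenization, Fintype.linearCombination_apply]

/-- In each multidegree the homogenized map is the original scalar matrix, restricted to the basis
vectors whose multidegree is at most `a`. The hypothesis `hm` ensures that the truncated difference
`δ' k - δ l` is a true difference wherever the entry is nonzero. -/
theorem multiComponent_homogenization {m : κ → ι → K} {δ' : κ → Fin u →₀ ℕ}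
    {δ : ι → Fin u →₀ ℕ} (hm : ∀ k l, m k l ≠ 0 → δ l ≤ δ' k) (x) (a) (l) :
    multiComponent δ (homogenization m δ' δ x) a l = ∑ k, multiComponent δ' x a k * m k l := by
  classical
  by_cases hl : δ l ≤ a
  · rw [multiComponent_of_le hl, homogenization_apply, coeff_sum]
    refine Finset.sum_congr rfl fun k _ => ?_
    by_cases h0 : m k l = 0
    · simp [h0]
    have hlk := hm k l h0
    rw [coeff_mul_monomial']
    by_cases hk : δ' k ≤ a
    · rw [multiComponent_of_le hk, if_pos (tsub_le_tsub_right hk _)]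
      congr 2
      ext i
      have h1 := hl i
      have h2 := hk i
      have h3 := hlk i
      simp only [Finsupp.coe_tsub, Pi.sub_apply]
      omega
    · rw [multiComponent_of_not_le hk, zero_mul, if_neg]
      intro h
      apply hk
      intro i
      have h1 := hl i
      have h2 := h i
      have h3 := hlk i
      simp only [Finsupp.coe_tsub, Pi.sub_apply] at h2
      omega
  · rw [multiComponent_of_not_le hl]
    refine (Finset.sum_eq_zero fun k _ => ?_).symm
    by_contra h0
    exact hl ((hm k l (right_ne_zero_of_mul h0)).trans
      (le_of_multiComponent_ne_zero (left_ne_zero_of_mul h0)))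

/-- Lifting along a homogenized matrix can be checked in every multidegree. -/
theorem exists_homogenization_eq [Fintype ι] {m : κ → ι → K} {δ' : κ → Fin u →₀ ℕ}
    {δ : ι → Fin u →₀ ℕ}
    (hm : ∀ k l, m k l ≠ 0 → δ l ≤ δ' k) (y : ι → MvPolynomial (Fin u) K)
    (hy : ∀ a, multiComponent δ y a ≠ 0 → ∃ w : κ → K, (∀ k, w k ≠ 0 → δ' k ≤ a) ∧
      ∀ l, ∑ k, w k * m k l = multiComponent δ y a l) :
    ∃ x, homogenization m δ' δ x = y := by
  classical
  obtain ⟨T, hT⟩ := exists_finset_multiComponent δ y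
  have h : ∀ a, ∃ w : κ → K, (multiComponent δ y a = 0 → w = 0) ∧ (∀ k, w k ≠ 0 → δ' k ≤ a) ∧
      ∀ l, ∑ k, w k * m k l = multiComponent δ y a l := fun a => by
    by_cases h0 : multiComponent δ y a = 0
    · exact ⟨0, fun _ => rfl, fun k hk => absurd rfl hk, fun l => by simp [h0]⟩
    · obtain ⟨w, hw⟩ := hy a h0
      exact ⟨w, fun h => absurd h h0, hw⟩
  choose w hw0 hwle hw using h
  obtain ⟨x, hx⟩ := exists_multiComponent_eq δ' T w (fun a ha => hw0 a (hT a ha)) hwle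
  refine ⟨x, multiComponent_ext (δ := δ) fun a l => ?_⟩
  rw [multiComponent_homogenization hm, hx, hw]

end Homogenization

section Resolution

variable {K : Type*} [Field K] {u : ℕ}

theorem homogenization_single {p q : ℕ} (m : Fin p → Fin q → K) (δ' : Fin p → Fin u →₀ ℕ)
    (δ : Fin q → Fin u →₀ ℕ) (k l) :
    homogenization m δ' δ (Pi.single k 1) l = monomial (δ' k - δ l) (m k l) := by
  simp [homogenization, Fintype.linearCombination_apply_single]

theorem monomial_mem_irrelevant {a : Fin u →₀ ℕ} (ha : a ≠ 0) (c : K) :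
    monomial a c ∈ Ideal.span (Set.range (X : Fin u → MvPolynomial (Fin u) K)) := by
  obtain ⟨i, hi⟩ := Finsupp.ne_iff.1 ha
  rw [← Set.image_univ, mem_ideal_span_X_image]
  intro b hb
  classical
  have := support_monomial_subset hb
  rw [Finset.mem_singleton.1 this]
  exact ⟨i, Set.mem_univ _, hi⟩

/-- The homogenization of a complex of based vector spaces that is exact in every multidegree is a
minimal graded free resolution. -/
def homogenizedResolution (I : Ideal (MvPolynomial (Fin u) K)) (b : ℕ → ℕ)
    (δ : (r : ℕ) → Fin (b r) → Fin u →₀ ℕ) (m : (r : ℕ) → Fin (b (r + 1)) → Fin (b r) → K)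
    (hm : ∀ r k l, m r k l ≠ 0 → δ r l < δ (r + 1) k)
    (hmm : ∀ r k l, ∑ j, m (r + 1) k j * m r j l = 0)
    (hex : ∀ a r (y : Fin (b (r + 1)) → K), (∀ k, y k ≠ 0 → δ (r + 1) k ≤ a) →
      (∀ l, ∑ k, y k * m r k l = 0) → ∃ w : Fin (b (r + 2)) → K,
        (∀ k, w k ≠ 0 → δ (r + 2) k ≤ a) ∧ ∀ l, ∑ k, w k * m (r + 1) k l = y l)
    (hb : b 0 = 1) (hδ : ∀ k, δ 0 k = 0)
    (hI : ∀ f, f ∈ I ↔ ∀ a ∈ f.support, ∃ w : Fin (b 1) → K, (∀ k, w k ≠ 0 → δ 1 k ≤ a) ∧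
      ∀ l, ∑ k, w k * m 0 k l = 1) :
    MinimalGradedFreeResolution I where
  rank := b
  shift r k := (δ r k).degree
  ε := (Submodule.mkQ I).comp (LinearMap.proj ⟨0, by omega⟩)
  d r := homogenization (m r) (δ (r + 1)) (δ r)
  ε_graded := by
    intro k
    refine ⟨1, ?_, ?_⟩
    · intro c hc
      have : c = 0 := by
        by_contra h
        exact (mem_support_iff.1 hc) (by simp [coeff_one, Ne.symm h])
      simp [this, hδ]
    · obtain rfl : k = ⟨0, by omega⟩ := by ext; have := k.2; simp only; omega
      simp
  d_graded := by
    intro i k l c hc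
    rw [homogenization_single] at hc
    have h0 : m i k l ≠ 0 := by
      rintro h0
      simp [h0] at hc
    rw [Finset.mem_singleton.1 (support_monomial_subset hc)]
    have := congrArg Finsupp.degree (tsub_add_cancel_of_le (hm i k l h0).le)
    rw [map_add] at this
    change ((δ (i + 1) k - δ i l).degree : ℤ) + ((δ i l).degree : ℤ) = (δ (i + 1) k).degree
    exact_mod_cast this
  ε_surjective := by
    intro y
    obtain ⟨f, rfl⟩ := Ideal.Quotient.mk_surjective y
    exact ⟨fun _ => f, rfl⟩
  exact_zero := by
    have huniq : ∀ k : Fin (b 0), k = ⟨0, by omega⟩ := fun k => by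
      ext; have := k.2; simp only; omega
    intro y
    have h1 : ((Submodule.mkQ I).comp (LinearMap.proj ⟨0, by omega⟩)) y = 0 ↔
        y ⟨0, by omega⟩ ∈ I := by
      rw [LinearMap.comp_apply, LinearMap.proj_apply, Submodule.mkQ_apply,
        Submodule.Quotient.mk_eq_zero]
    have hcoeff : ∀ a k, multiComponent (δ 0) y a k = coeff a (y k) := fun a k => by
      rw [multiComponent_of_le (by rw [hδ]; exact zero_le), hδ, tsub_zero]
    rw [h1, hI]
    constructor
    · intro h
      refine exists_homogenization_eq (fun k l hkl => (hm 0 k l hkl).le) y fun a ha => ?_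
      obtain ⟨k, hk⟩ := Function.ne_iff.1 ha
      rw [hcoeff, huniq k] at hk
      obtain ⟨w, hw, hw1⟩ := h a (mem_support_iff.2 hk)
      -- The vector `w` hits `1` in multidegree `a`; scaling it hits the coefficient of `x^a`. The
      -- converse below divides by that coefficient.
      refine ⟨coeff a (y ⟨0, by omega⟩) • w, fun k hk => hw k fun h0 => hk (by simp [h0]),
        fun l => ?_⟩
      rw [hcoeff, huniq l]
      simp only [Pi.smul_apply, smul_eq_mul, mul_assoc]
      rw [← Finset.mul_sum, hw1, mul_one]
    · rintro ⟨x, rfl⟩ a ha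
      have ha' := mem_support_iff.1 ha
      rw [← hcoeff, multiComponent_homogenization (fun k l hkl => (hm 0 k l hkl).le)] at ha'
      refine ⟨(∑ k, multiComponent (δ 1) x a k * m 0 k ⟨0, by omega⟩)⁻¹ •
        multiComponent (δ 1) x a, fun k hk => le_of_multiComponent_ne_zero
          (right_ne_zero_of_mul hk), fun l => ?_⟩
      rw [huniq l]
      simp only [Pi.smul_apply, smul_eq_mul, mul_assoc]
      rw [← Finset.mul_sum, inv_mul_cancel₀ ha']
  exact_succ := by
    intro r y
    constructor
    · intro hy
      refine exists_homogenization_eq (fun k l hkl => (hm _ k l hkl).le) y fun a ha => ?_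
      refine hex a r _ (fun k => le_of_multiComponent_ne_zero) fun l => ?_
      rw [← multiComponent_homogenization (fun k l hkl => (hm r k l hkl).le), hy,
        multiComponent_zero]
    · rintro ⟨x, rfl⟩
      refine multiComponent_ext (δ := δ r) fun a l => ?_
      rw [multiComponent_homogenization (fun k l hkl => (hm r k l hkl).le), multiComponent_zero]
      simp only [multiComponent_homogenization (fun k l hkl => (hm (r + 1) k l hkl).le),
        Finset.sum_mul]
      rw [Finset.sum_comm]
      refine Finset.sum_eq_zero fun k _ => ?_
      simp only [mul_assoc]
      rw [← Finset.mul_sum, hmm, mul_zero]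
  minimal := by
    intro r x l
    rw [homogenization_apply]
    refine Ideal.sum_mem _ fun k _ => Ideal.mul_mem_left _ _ ?_
    by_cases h0 : m r k l = 0
    · simp [h0]
    -- Multidegrees strictly increase along nonzero entries, so the monomial is not constant.
    · refine monomial_mem_irrelevant (fun h => ?_) _
      exact absurd (tsub_eq_zero_iff_le.1 h) (hm r k l h0).not_ge

end Resolution

section FromPoset

variable {K : Type*} [Field K] {L : Type*} [SemilatticeInf L] [OrderBot L] [Finite L]

/-- An enumeration of the basis in degree `r`. -/
def basisEquiv (K : Type*) [Field K] (rk : L → ℕ) (r : ℕ) :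
    (homologyComplex K rk r).basis ≃ Fin (Nat.card (homologyComplex K rk r).basis) :=
  Finite.equivFin _

/-- The matrix of the differential. -/
def boundaryMatrix (K : Type*) [Field K] (rk : L → ℕ) (r : ℕ)
    (k : Fin (Nat.card (homologyComplex K rk (r + 1)).basis))
    (l : Fin (Nat.card (homologyComplex K rk r).basis)) : K :=
  boundary K rk r (Finsupp.single ((basisEquiv K rk (r + 1)).symm k) 1)
    ((basisEquiv K rk r).symm l)

/-- The chain with given coordinates. -/
def chainOf (K : Type*) [Field K] (rk : L → ℕ) (r : ℕ)
    (w : Fin (Nat.card (homologyComplex K rk r).basis) → K) : (homologyComplex K rk r).basis →₀ K :=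
  Finsupp.equivFunOnFinite.symm (w ∘ basisEquiv K rk r)

variable {rk : L → ℕ}

theorem chainOf_apply (r : ℕ) (w) (c) : chainOf K rk r w c = w (basisEquiv K rk r c) := rfl

theorem chainOf_coordinates (r : ℕ) (x : (homologyComplex K rk r).basis →₀ K) :
    chainOf K rk r (fun k => x ((basisEquiv K rk r).symm k)) = x := by
  ext c
  simp [chainOf_apply]

theorem chainOf_eq_sum (r : ℕ) (w) :
    chainOf K rk r w = ∑ k, w k • Finsupp.single ((basisEquiv K rk r).symm k) (1 : K) := by
  ext c
  rw [Finsupp.finsetSum_apply, chainOf_apply,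
    Finset.sum_eq_single_of_mem (basisEquiv K rk r c) (Finset.mem_univ _)]
  · simp
  · intro k _ hk
    rw [Finsupp.smul_apply, Finsupp.single_apply_eq_zero.2, smul_zero]
    rintro rfl
    simp at hk

theorem boundary_chainOf (r : ℕ) (w) (l) :
    boundary K rk r (chainOf K rk (r + 1) w) ((basisEquiv K rk r).symm l) =
      ∑ k, w k * boundaryMatrix K rk r k l := by
  rw [chainOf_eq_sum, map_sum, Finsupp.finsetSum_apply]
  simp only [map_smul, Finsupp.smul_apply, smul_eq_mul]
  rfl

theorem chainOf_mem_chains {r : ℕ} {w} {P : Set L}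
    (h : ∀ k, w k ≠ 0 → (homologyComplex K rk r).label ((basisEquiv K rk r).symm k) ∈ P) :
    chainOf K rk r w ∈ (homologyComplex K rk r).chains P := by
  refine (Finsupp.mem_supported _ _).2 fun c hc => ?_
  have := h (basisEquiv K rk r c) (Finsupp.mem_support_iff.1 hc)
  rwa [Equiv.symm_apply_apply] at this

variable {u : ℕ}

/-- The minimal graded free resolution attached to a poset whose elements have multidegrees. -/
def posetResolution (K : Type*) [Field K] (hrk : IsCogeometricRank rk) (deg : L → Fin u →₀ ℕ)
    (hdeg : StrictMono deg) (hbot : deg ⊥ = 0) (top : (Fin u →₀ ℕ) → L)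
    (htop : ∀ a D, deg D ≤ a ↔ D ≤ top a) (I : Ideal (MvPolynomial (Fin u) K))
    (hI : ∀ f, f ∈ I ↔ ∀ a ∈ f.support, top a ≠ ⊥) : MinimalGradedFreeResolution I :=
  homogenizedResolution I (fun r => Nat.card (homologyComplex K rk r).basis)
    (fun r k => deg ((homologyComplex K rk r).label ((basisEquiv K rk r).symm k)))
    (boundaryMatrix K rk)
    (by
      intro r k l h
      have h1 := (boundary_single_mem r ((basisEquiv K rk (r + 1)).symm k)).1
      have h2 := (Finsupp.mem_supported _ _).1 h1 (Finsupp.mem_support_iff.2 h)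
      -- The labels are comparable, and they differ because their ranks are `r` and `r + 1`.
      refine hdeg (lt_of_le_of_ne h2 fun h3 => ?_)
      have h4 := congrArg rk h3
      rw [rank_label hrk.bot, rank_label hrk.bot] at h4
      omega)
    (by
      intro r k l
      have h := DFunLike.congr_fun (diff_boundary (r + 1)
        (Finsupp.single ((basisEquiv K rk (r + 2)).symm k) (1 : K))) ((basisEquiv K rk r).symm l)
      rw [← chainOf_coordinates (r + 1) (boundary K rk (r + 1) _)] at h
      exact (boundary_chainOf r _ l).symm.trans h)
    (by
      intro a r y hy hy0
      have h1 : chainOf K rk (r + 1) y ∈ (homologyComplex K rk (r + 1)).chains (Set.Iic (top a)) :=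
        chainOf_mem_chains fun k hk => (htop a _).1 (hy k hk)
      have h2 : boundary K rk r (chainOf K rk (r + 1) y) = 0 := by
        ext c
        obtain ⟨l, rfl⟩ := (basisEquiv K rk r).symm.surjective c
        rw [boundary_chainOf, hy0]
        rfl
      obtain ⟨z, hz, hzy⟩ : ∃ z ∈ (homologyComplex K rk (r + 2)).chains (Set.Iic (top a)),
          boundary K rk (r + 1) z = chainOf K rk (r + 1) y := by
        -- When `top a = ⊥` there is no label of positive rank below it, so the chain is already
        -- zero.
        by_cases ht : top a = ⊥
        · refine ⟨0, zero_mem _, ?_⟩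
          rw [LabelledStage.chains_eq_bot] at h1
          · rw [map_zero, (Submodule.mem_bot K).1 h1]
          · intro c hc
            have h3 := rank_label (K := K) hrk.bot (r + 1) c
            rw [ht] at hc
            rw [le_bot_iff.1 hc, hrk.bot] at h3
            omega
        · exact exact_below hrk ht h1 h2
      refine ⟨fun k => z ((basisEquiv K rk (r + 2)).symm k), fun k hk => (htop a _).2
        ((Finsupp.mem_supported _ _).1 hz (Finsupp.mem_support_iff.2 hk)), fun l => ?_⟩
      rw [← boundary_chainOf, chainOf_coordinates, hzy, chainOf_apply, Equiv.apply_symm_apply])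
    (Nat.card_unique (α := PUnit))
    (fun _ => hbot)
    (by
      intro f
      rw [hI]
      refine forall₂_congr fun a _ => ⟨fun ht => ?_, ?_⟩
      -- Exactness in degree `0` says that the single generator of `F_0` bounds below `top a`, which
      -- is membership of `x^a` in the image of the first differential.
      · obtain ⟨z, hz, hz1⟩ := exact_below (K := K) (r := 0) hrk ht
          (z := Finsupp.single PUnit.unit 1)
          (Finsupp.single_mem_supported _ _ (bot_le : ⊥ ≤ top a)) rfl
        refine ⟨fun k => z ((basisEquiv K rk 1).symm k), fun k hk => (htop a _).2
          ((Finsupp.mem_supported _ _).1 hz (Finsupp.mem_support_iff.2 hk)), fun l => ?_⟩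
        rw [← boundary_chainOf, chainOf_coordinates, hz1]
        exact Finsupp.single_eq_same
      · rintro ⟨w, hw, hw1⟩ ht
        have h1 : chainOf K rk 1 w ∈ (homologyComplex K rk 1).chains (Set.Iic (top a)) :=
          chainOf_mem_chains fun k hk => (htop a _).1 (hw k hk)
        rw [LabelledStage.chains_eq_bot] at h1
        · have h2 := boundary_chainOf 0 w (basisEquiv K rk 0 PUnit.unit)
          rw [hw1, (Submodule.mem_bot K).1 h1, map_zero] at h2
          exact zero_ne_one h2
        · intro c hc
          have h3 := rank_label (K := K) hrk.bot 1 c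
          rw [ht] at hc
          rw [le_bot_iff.1 hc, hrk.bot] at h3
          omega)

/-- The shifts are degrees of labels by construction; that no element of the poset is missed is the
nonvanishing `exists_label_eq`. -/
theorem range_shift_posetResolution (K : Type*) [Field K] (hrk : IsCogeometricRank rk)
    (deg : L → Fin u →₀ ℕ) (hdeg : StrictMono deg) (hbot : deg ⊥ = 0) (top : (Fin u →₀ ℕ) → L)
    (htop : ∀ a D, deg D ≤ a ↔ D ≤ top a) (I : Ideal (MvPolynomial (Fin u) K))
    (hI : ∀ f, f ∈ I ↔ ∀ a ∈ f.support, top a ≠ ⊥) (r : ℕ) :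
    Set.range ((posetResolution K hrk deg hdeg hbot top htop I hI).shift r) =
      {t : ℤ | ∃ D, rk D = r ∧ ((deg D).degree : ℤ) = t} := by
  ext t
  constructor
  · rintro ⟨k, rfl⟩
    exact ⟨_, rank_label hrk.bot r _, rfl⟩
  · rintro ⟨D, hD, rfl⟩
    obtain ⟨c, hc⟩ := exists_label_eq (K := K) hrk r D hD
    refine ⟨basisEquiv K rk r c, ?_⟩
    change ((deg _).degree : ℤ) = _
    rw [Equiv.symm_apply_apply, hc]

end FromPoset

end

end ModularCode

/-! ### Uniqueness of the shifts of minimal graded free resolutions -/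

namespace ModularCode

noncomputable section

open MvPolynomial

section Graded

variable {K : Type*} [Field K] {u : ℕ}

/-- The homogeneous component of degree `t` of a polynomial, for `t` an integer. -/
abbrev degreePart (t : ℤ) : MvPolynomial (Fin u) K →ₗ[K] MvPolynomial (Fin u) K :=
  weightedHomogeneousComponent (fun _ : Fin u => (1 : ℤ)) t

/-- Being homogeneous of degree `t`, for `t` an integer. -/
abbrev IsHomogeneousOfDegree (f : MvPolynomial (Fin u) K) (t : ℤ) : Prop :=
  IsWeightedHomogeneous (fun _ : Fin u => (1 : ℤ)) f t

theorem weight_one_eq_degree (c : Fin u →₀ ℕ) :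
    Finsupp.weight (fun _ : Fin u => (1 : ℤ)) c = (c.degree : ℤ) := by
  rw [Finsupp.weight_apply, Finsupp.degree_apply, Finsupp.sum]
  simp

theorem isHomogeneousOfDegree_iff {f : MvPolynomial (Fin u) K} {t : ℤ} :
    IsHomogeneousOfDegree f t ↔ ∀ c ∈ f.support, (c.degree : ℤ) = t := by
  simp only [IsHomogeneousOfDegree, IsWeightedHomogeneous, weight_one_eq_degree, mem_support_iff]

theorem degreePart_mul {p q : MvPolynomial (Fin u) K} {m : ℤ} (hp : IsHomogeneousOfDegree p m)
    (n : ℤ) : degreePart n (q * p) = degreePart (n - m) q * p := by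
  induction q using MvPolynomial.induction_on' with
  | monomial d c =>
    have hd : IsHomogeneousOfDegree (monomial d c : MvPolynomial (Fin u) K) (d.degree : ℤ) :=
      isWeightedHomogeneous_monomial _ _ _ (weight_one_eq_degree d)
    have hmul := hd.mul hp
    rw [degreePart, degreePart, weightedHomogeneousComponent_of_mem hd,
      weightedHomogeneousComponent_of_mem hmul]
    by_cases h : n = d.degree + m
    · rw [if_pos h, if_pos (by omega)]
    · rw [if_neg h, if_neg (by omega), zero_mul]
  | add p q hp hq => rw [add_mul, map_add, hp, hq, map_add, add_mul]

variable {ι κ : Type*}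

theorem isHomogeneousVec_iff {b : ℕ} {a : Fin b → ℤ} {t : ℤ}
    {x : Fin b → MvPolynomial (Fin u) K} :
    IsHomogeneousVec a t x ↔ ∀ k, IsHomogeneousOfDegree (x k) (t - a k) := by
  simp only [IsHomogeneousVec, isHomogeneousOfDegree_iff, eq_sub_iff_add_eq]

/-- The homogeneous component of degree `t` of an element of a graded free module. -/
def vecPart (a : ι → ℤ) (t : ℤ) (x : ι → MvPolynomial (Fin u) K) : ι → MvPolynomial (Fin u) K :=
  fun k => degreePart (t - a k) (x k)

theorem isHomogeneousVec_vecPart {b : ℕ} (a : Fin b → ℤ) (t : ℤ)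
    (x : Fin b → MvPolynomial (Fin u) K) : IsHomogeneousVec a t (vecPart a t x) :=
  isHomogeneousVec_iff.2 fun _ => weightedHomogeneousComponent_isWeightedHomogeneous _ _

theorem vecPart_of_isHomogeneousVec {b : ℕ} {a : Fin b → ℤ} {t : ℤ}
    {x : Fin b → MvPolynomial (Fin u) K} (h : IsHomogeneousVec a t x) : vecPart a t x = x :=
  funext fun k => weightedHomogeneousComponent_eq_self (isHomogeneousVec_iff.1 h k)

theorem isHomogeneousVec_single {b : ℕ} (a : Fin b → ℤ) (k : Fin b) :
    IsHomogeneousVec a (a k) (Pi.single k 1 : Fin b → MvPolynomial (Fin u) K) := by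
  intro l c hc
  by_cases h : l = k
  · subst h
    rw [Pi.single_eq_same] at hc
    have : c = 0 := by
      by_contra h
      exact (mem_support_iff.1 hc) (by simp [coeff_one, Ne.symm h])
    simp [this]
  · simp [Pi.single_eq_of_ne h] at hc

theorem IsHomogeneousVec.sub {b : ℕ} {a : Fin b → ℤ} {t : ℤ}
    {x y : Fin b → MvPolynomial (Fin u) K} (hx : IsHomogeneousVec a t x)
    (hy : IsHomogeneousVec a t y) : IsHomogeneousVec a t (x - y) :=
  isHomogeneousVec_iff.2 fun k => (isHomogeneousVec_iff.1 hx k).sub (isHomogeneousVec_iff.1 hy k)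

/-- A linear map between graded free modules that is graded of degree `0`. -/
def IsGradedMap {p q : ℕ} (a : Fin p → ℤ) (b : Fin q → ℤ)
    (φ : (Fin p → MvPolynomial (Fin u) K) →ₗ[MvPolynomial (Fin u) K]
      (Fin q → MvPolynomial (Fin u) K)) : Prop :=
  ∀ k, IsHomogeneousVec b (a k) (φ (Pi.single k 1))

variable {p q : ℕ} {a : Fin p → ℤ} {b : Fin q → ℤ}
  {φ : (Fin p → MvPolynomial (Fin u) K) →ₗ[MvPolynomial (Fin u) K]
    (Fin q → MvPolynomial (Fin u) K)}

theorem IsGradedMap.map_vecPart (hφ : IsGradedMap a b φ) (t : ℤ) (x) :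
    φ (vecPart a t x) = vecPart b t (φ x) := by
  funext l
  rw [LinearMap.pi_apply_eq_sum_univ, vecPart, LinearMap.pi_apply_eq_sum_univ φ x]
  simp only [Finset.sum_apply, Pi.smul_apply, smul_eq_mul, map_sum]
  refine Finset.sum_congr rfl fun k _ => ?_
  have := isHomogeneousVec_iff.1 (hφ k) l
  have hs : (fun j => if k = j then (1 : MvPolynomial (Fin u) K) else 0) = Pi.single k 1 := by
    funext j
    simp [Pi.single_apply, eq_comm]
  rw [hs, degreePart_mul this, vecPart]
  congr 2
  ring_nf

theorem IsGradedMap.isHomogeneousVec (hφ : IsGradedMap a b φ) {t : ℤ} {x}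
    (hx : IsHomogeneousVec a t x) : IsHomogeneousVec b t (φ x) := by
  rw [← vecPart_of_isHomogeneousVec hx, hφ.map_vecPart]
  exact isHomogeneousVec_vecPart _ _ _

/-- The ideal `(x_1, ..., x_u)`. -/
abbrev irrelevantIdeal (K : Type*) [Field K] (u : ℕ) : Ideal (MvPolynomial (Fin u) K) :=
  Ideal.span (Set.range (X : Fin u → MvPolynomial (Fin u) K))

theorem mem_irrelevantIdeal_iff {f : MvPolynomial (Fin u) K} :
    f ∈ irrelevantIdeal K u ↔ coeff 0 f = 0 := by
  constructor
  · intro h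
    have : irrelevantIdeal K u ≤ RingHom.ker (constantCoeff (σ := Fin u) (R := K)) := by
      rw [Ideal.span_le]
      rintro _ ⟨i, rfl⟩
      simp
    exact this h
  · intro h
    rw [as_sum f]
    refine Ideal.sum_mem _ fun c hc => monomial_mem_irrelevant ?_ _
    rintro rfl
    exact mem_support_iff.1 hc h

/-- Lift a family of values on the basis vectors to a graded map. -/
theorem exists_gradedMap {Q : Type*} [AddCommGroup Q] [Module (MvPolynomial (Fin u) K) Q]
    (π : (Fin p → MvPolynomial (Fin u) K) →ₗ[MvPolynomial (Fin u) K] Q)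
    (π' : (Fin q → MvPolynomial (Fin u) K) →ₗ[MvPolynomial (Fin u) K] Q)
    (h : ∀ k, ∃ y, IsHomogeneousVec b (a k) y ∧ π' y = π (Pi.single k 1)) :
    ∃ φ : (Fin p → MvPolynomial (Fin u) K) →ₗ[MvPolynomial (Fin u) K]
      (Fin q → MvPolynomial (Fin u) K), IsGradedMap a b φ ∧ ∀ x, π' (φ x) = π x := by
  choose y hy hyπ using h
  have hs : ∀ k, Fintype.linearCombination (MvPolynomial (Fin u) K) y (Pi.single k 1) = y k := by
    intro k
    simp [Fintype.linearCombination_apply_single]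
  refine ⟨Fintype.linearCombination _ y, fun k => by rw [hs]; exact hy k, fun x => ?_⟩
  have : π' ∘ₗ Fintype.linearCombination _ y = π := by
    refine LinearMap.pi_ext' fun k => LinearMap.ext_ring ?_
    simp [hyπ]
  exact LinearMap.congr_fun this x

/-- Graded Nakayama. Take a basis vector of least degree outside the image and lift its value under
`π'` to `y`. Its difference with `φ y` lies in `ker π'`, so the coordinates are in the irrelevant
ideal, and the basis vectors involved have smaller degree. These are in the image, a contradiction.
-/
theorem exists_gradedMap_surjective {Q : Type*} [AddCommGroup Q]
    [Module (MvPolynomial (Fin u) K) Q]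
    {π : (Fin p → MvPolynomial (Fin u) K) →ₗ[MvPolynomial (Fin u) K] Q}
    {π' : (Fin q → MvPolynomial (Fin u) K) →ₗ[MvPolynomial (Fin u) K] Q}
    (hπ' : ∀ x, π' x = 0 → ∀ k, x k ∈ irrelevantIdeal K u)
    (h' : ∀ k, ∃ y, IsHomogeneousVec a (b k) y ∧ π y = π' (Pi.single k 1))
    (hφ : IsGradedMap a b φ) (hφπ : ∀ x, π' (φ x) = π x) : Function.Surjective φ := by
  classical
  rw [← LinearMap.range_eq_top]
  have key : ∀ k, (Pi.single k 1 : Fin q → MvPolynomial (Fin u) K) ∈ LinearMap.range φ := by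
    by_contra! hcon
    obtain ⟨k, hk, hmin⟩ := Finset.exists_min_image (Finset.univ.filter fun k =>
      (Pi.single k 1 : Fin q → MvPolynomial (Fin u) K) ∉ LinearMap.range φ) b
      (by obtain ⟨k, hk⟩ := hcon; exact ⟨k, by simpa using hk⟩)
    rw [Finset.mem_filter] at hk
    apply hk.2
    obtain ⟨y, hy, hyk⟩ := h' k
    have hz : IsHomogeneousVec b (b k) (Pi.single k 1 - φ y) :=
      (isHomogeneousVec_single b k).sub (hφ.isHomogeneousVec hy)
    have hzm := hπ' (Pi.single k 1 - φ y) (by rw [map_sub, hφπ, hyk, sub_self])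
    rw [← sub_add_cancel (Pi.single k 1) (φ y)]
    refine add_mem ?_ ⟨y, rfl⟩
    generalize Pi.single k 1 - φ y = z at hz hzm
    rw [pi_eq_sum_univ z]
    refine Submodule.sum_mem _ fun l _ => ?_
    by_cases h0 : z l = 0
    · simp [h0]
    · obtain ⟨c, hc⟩ := support_nonempty.2 h0
      have hc0 : c ≠ 0 := by
        rintro rfl
        exact mem_support_iff.1 hc (mem_irrelevantIdeal_iff.1 (hzm l))
      have hlt : b l < b k := by
        have := hz l c hc
        have : c.degree ≠ 0 := fun h => hc0 ((Finsupp.degree_eq_zero_iff c).1 h)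
        omega
      refine Submodule.smul_mem _ _ ?_
      have hs : (fun j => if l = j then (1 : MvPolynomial (Fin u) K) else 0) = Pi.single l 1 := by
        funext j
        simp [Pi.single_apply, eq_comm]
      rw [hs]
      by_contra hl
      exact absurd (hmin l (by simpa using hl)) (not_le.2 hlt)
  refine eq_top_iff.2 fun y _ => ?_
  rw [pi_eq_sum_univ' y]
  exact Submodule.sum_mem _ fun l _ => Submodule.smul_mem _ _ (key l)

/-- Minimal graded covers of the same module are isomorphic. -/
theorem exists_gradedEquiv {Q : Type*} [AddCommGroup Q] [Module (MvPolynomial (Fin u) K) Q]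
    (π : (Fin p → MvPolynomial (Fin u) K) →ₗ[MvPolynomial (Fin u) K] Q)
    (π' : (Fin q → MvPolynomial (Fin u) K) →ₗ[MvPolynomial (Fin u) K] Q)
    (hπ : ∀ x, π x = 0 → ∀ k, x k ∈ irrelevantIdeal K u)
    (hπ' : ∀ x, π' x = 0 → ∀ k, x k ∈ irrelevantIdeal K u)
    (h : ∀ k, ∃ y, IsHomogeneousVec b (a k) y ∧ π' y = π (Pi.single k 1))
    (h' : ∀ k, ∃ y, IsHomogeneousVec a (b k) y ∧ π y = π' (Pi.single k 1)) :
    ∃ φ : (Fin p → MvPolynomial (Fin u) K) ≃ₗ[MvPolynomial (Fin u) K]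
      (Fin q → MvPolynomial (Fin u) K),
      IsGradedMap a b (φ : _ →ₗ[MvPolynomial (Fin u) K] _) ∧ ∀ x, π' (φ x) = π x := by
  obtain ⟨φ, hφ, hφπ⟩ := exists_gradedMap π π' h
  obtain ⟨ψ, hψ, hψπ⟩ := exists_gradedMap π' π h'
  have h1 : Function.Surjective φ := exists_gradedMap_surjective hπ' h' hφ hφπ
  have h2 : Function.Surjective ψ := exists_gradedMap_surjective hπ h hψ hψπ
  have h3 : Function.Injective φ := by
    have := IsNoetherian.injective_of_surjective_endomorphism (ψ ∘ₗ φ) (h2.comp h1)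
    exact Function.Injective.of_comp this
  exact ⟨LinearEquiv.ofBijective φ ⟨h3, h1⟩, hφ, hφπ⟩

/-- If the degree of `e_k` is not a shift of the target, no coordinate of `φ e_k` has a constant
term. So `φ e_k` lies in the irrelevant ideal times the module, and applying the inverse puts `e_k`
there too, which is absurd. -/
theorem range_subset_of_gradedEquiv
    (φ : (Fin p → MvPolynomial (Fin u) K) ≃ₗ[MvPolynomial (Fin u) K]
      (Fin q → MvPolynomial (Fin u) K))
    (hφ : IsGradedMap a b (φ : _ →ₗ[MvPolynomial (Fin u) K] _)) : Set.range a ⊆ Set.range b := by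
  rintro _ ⟨k, rfl⟩
  by_contra hk
  have h1 : ∀ l, φ (Pi.single k 1) l ∈ irrelevantIdeal K u := by
    intro l
    rw [mem_irrelevantIdeal_iff]
    by_contra h0
    have := hφ k l 0 (mem_support_iff.2 h0)
    exact hk ⟨l, by simpa using this⟩
  have h2 : (Pi.single k 1 : Fin p → MvPolynomial (Fin u) K) k ∈ irrelevantIdeal K u := by
    rw [← φ.symm_apply_apply (Pi.single k 1), pi_eq_sum_univ' (φ (Pi.single k 1)), map_sum,
      Finset.sum_apply]
    refine Ideal.sum_mem _ fun l _ => ?_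
    rw [map_smul, Pi.smul_apply, smul_eq_mul]
    exact Ideal.mul_mem_right _ _ (h1 l)
  rw [Pi.single_eq_same, mem_irrelevantIdeal_iff] at h2
  simp at h2

end Graded

section Uniqueness

variable {K : Type*} [Field K] {u : ℕ} {I : Ideal (MvPolynomial (Fin u) K)}

theorem MinimalGradedFreeResolution.mem_irrelevantIdeal_of_ε_eq_zero
    (F : MinimalGradedFreeResolution I) (x) (hx : F.ε x = 0) (k) :
    x k ∈ irrelevantIdeal K u := by
  obtain ⟨y, rfl⟩ := (F.exact_zero x).1 hx
  exact F.minimal 0 y k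

theorem MinimalGradedFreeResolution.mem_irrelevantIdeal_of_d_eq_zero
    (F : MinimalGradedFreeResolution I) (r : ℕ) (x) (hx : F.d r x = 0) (k) :
    x k ∈ irrelevantIdeal K u := by
  obtain ⟨y, rfl⟩ := (F.exact_succ r x).1 hx
  exact F.minimal (r + 1) y k

/-- Any preimage can be replaced by its component of the right degree, because `I` contains the
homogeneous components of its elements. -/
theorem MinimalGradedFreeResolution.exists_homogeneous_ε_eq
    (hI : ∀ f ∈ I, ∀ t : ℤ, degreePart t f ∈ I) (F G : MinimalGradedFreeResolution I) (k) :
    ∃ y, IsHomogeneousVec (G.shift 0) (F.shift 0 k) y ∧ G.ε y = F.ε (Pi.single k 1) := by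
  obtain ⟨f, hf, hfk⟩ := F.ε_graded k
  choose g hg hgk using G.ε_graded
  have hG : ∀ y, G.ε y = Ideal.Quotient.mk I (∑ l, y l * g l) := by
    intro y
    conv_lhs => rw [pi_eq_sum_univ' y]
    rw [map_sum, map_sum]
    refine Finset.sum_congr rfl fun l _ => ?_
    rw [map_smul, hgk, map_mul]
    rfl
  obtain ⟨y, hy⟩ := G.ε_surjective (Ideal.Quotient.mk I f)
  refine ⟨vecPart (G.shift 0) (F.shift 0 k) y, isHomogeneousVec_vecPart _ _ _, ?_⟩
  rw [hG, Ideal.Quotient.eq] at hy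
  rw [hfk, hG, Ideal.Quotient.eq]
  have := hI _ hy (F.shift 0 k)
  rw [map_sub, map_sum, weightedHomogeneousComponent_eq_self
    (isHomogeneousOfDegree_iff.2 hf)] at this
  convert this using 3 with l
  exact (degreePart_mul (isHomogeneousOfDegree_iff.2 (hg l)) _).symm

/-- The clause on ranges makes the induction run: once `φ` matches the images of the two
differentials, `φ ∘ F.d r` and `G.d r` are minimal graded covers of the same submodule, hence
isomorphic. Exactness then matches the images one step further. -/
theorem MinimalGradedFreeResolution.exists_gradedEquiv
    (hI : ∀ f ∈ I, ∀ t : ℤ, degreePart t f ∈ I) (F G : MinimalGradedFreeResolution I) (r : ℕ) :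
    ∃ φ : (Fin (F.rank r) → MvPolynomial (Fin u) K) ≃ₗ[MvPolynomial (Fin u) K]
      (Fin (G.rank r) → MvPolynomial (Fin u) K),
      IsGradedMap (F.shift r) (G.shift r) (φ : _ →ₗ[MvPolynomial (Fin u) K] _) ∧
      ∀ x, x ∈ Set.range (F.d r) ↔ φ x ∈ Set.range (G.d r) := by
  induction r with
  | zero =>
    obtain ⟨φ, hφ, h⟩ := ModularCode.exists_gradedEquiv F.ε G.ε F.mem_irrelevantIdeal_of_ε_eq_zero
      G.mem_irrelevantIdeal_of_ε_eq_zero (exists_homogeneous_ε_eq hI F G)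
      (exists_homogeneous_ε_eq hI G F)
    exact ⟨φ, hφ, fun x => by rw [← F.exact_zero x, ← G.exact_zero (φ x), h]⟩
  | succ r ih =>
    obtain ⟨φ, hφ, hd⟩ := ih
    have h1 : ∀ k, ∃ y, IsHomogeneousVec (G.shift (r + 1)) (F.shift (r + 1) k) y ∧
        G.d r y = φ (F.d r (Pi.single k 1)) := by
      intro k
      obtain ⟨y, hy⟩ := (hd _).1 ⟨Pi.single k 1, rfl⟩
      refine ⟨vecPart _ _ y, isHomogeneousVec_vecPart _ _ _, ?_⟩
      rw [IsGradedMap.map_vecPart (G.d_graded r), hy]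
      exact vecPart_of_isHomogeneousVec (hφ.isHomogeneousVec (F.d_graded r k))
    have h2 : ∀ k, ∃ y, IsHomogeneousVec (F.shift (r + 1)) (G.shift (r + 1) k) y ∧
        φ (F.d r y) = G.d r (Pi.single k 1) := by
      intro k
      obtain ⟨y, hy⟩ := (hd (φ.symm (G.d r (Pi.single k 1)))).2
        ⟨Pi.single k 1, (φ.apply_symm_apply _).symm⟩
      refine ⟨vecPart _ _ y, isHomogeneousVec_vecPart _ _ _, ?_⟩
      rw [IsGradedMap.map_vecPart (F.d_graded r)]
      refine (hφ.map_vecPart _ _).trans ?_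
      rw [hy, LinearEquiv.coe_coe, φ.apply_symm_apply]
      exact vecPart_of_isHomogeneousVec (G.d_graded r k)
    obtain ⟨ψ, hψ, h⟩ := ModularCode.exists_gradedEquiv
      ((φ : _ →ₗ[MvPolynomial (Fin u) K] _) ∘ₗ F.d r) (G.d r)
      (fun x hx => F.mem_irrelevantIdeal_of_d_eq_zero r x (φ.map_eq_zero_iff.1 hx))
      (G.mem_irrelevantIdeal_of_d_eq_zero r) h1 h2
    refine ⟨ψ, hψ, fun x => ?_⟩
    rw [← F.exact_succ r x, ← G.exact_succ r (ψ x), h]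
    exact φ.map_eq_zero_iff.symm

/-- The degrees of the generators of a minimal graded free resolution do not depend on it. -/
theorem MinimalGradedFreeResolution.range_shift_eq
    (hI : ∀ f ∈ I, ∀ t : ℤ, degreePart t f ∈ I) (F G : MinimalGradedFreeResolution I) (r : ℕ) :
    Set.range (F.shift r) = Set.range (G.shift r) := by
  obtain ⟨φ, hφ, -⟩ := F.exists_gradedEquiv hI G r
  obtain ⟨ψ, hψ, -⟩ := G.exists_gradedEquiv hI F r
  exact (range_subset_of_gradedEquiv φ hφ).antisymm (range_subset_of_gradedEquiv ψ hψ)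

theorem MinimalGradedFreeResolution.betti_ne_zero_iff (F : MinimalGradedFreeResolution I)
    (i : ℕ) (j : ℤ) : F.betti i j ≠ 0 ↔ j ∈ Set.range (F.shift i) := by
  rw [betti, Finset.card_ne_zero, Finset.filter_nonempty_iff]
  simp

/-- The least degree of a nonzero element of a graded free module. -/
theorem isLeast_degree_of_isLeast_shift {b : ℕ} {a : Fin b → ℤ} {t : ℤ}
    (h : IsLeast (Set.range a) t) :
    IsLeast {t : ℤ | ∃ x : Fin b → MvPolynomial (Fin u) K, x ≠ 0 ∧ IsHomogeneousVec a t x} t := by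
  obtain ⟨⟨k, rfl⟩, hk⟩ := h
  refine ⟨⟨Pi.single k 1, by simp, isHomogeneousVec_single a k⟩, ?_⟩
  rintro s ⟨x, hx, hs⟩
  obtain ⟨l, hl⟩ := Function.ne_iff.1 hx
  obtain ⟨c, hc⟩ := support_nonempty.2 hl
  have h1 := hs l c hc
  have h2 := hk ⟨l, rfl⟩
  omega

end Uniqueness

end

end ModularCode

/-! ### Projective dimension from a minimal resolution -/

namespace ModularCode

noncomputable section

open MvPolynomial CategoryTheory

variable {K : Type*} [Field K] {u : ℕ} {I : Ideal (MvPolynomial (Fin u) K)}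

namespace MinimalGradedFreeResolution

variable (F : MinimalGradedFreeResolution I)

/-- The `i`-th cokernel `F_i / d(F_{i+1})`. -/
abbrev Coker (i : ℕ) : Type _ :=
  (Fin (F.rank i) → MvPolynomial (Fin u) K) ⧸ LinearMap.range (F.d i)

theorem range_d_le_ker_d (i : ℕ) : LinearMap.range (F.d (i + 1)) ≤ LinearMap.ker (F.d i) :=
  fun x hx => (F.exact_succ i x).2 hx

/-- The map from a cokernel to the preceding free module. -/
def cokerMap (i : ℕ) :
    F.Coker (i + 1) →ₗ[MvPolynomial (Fin u) K] (Fin (F.rank i) → MvPolynomial (Fin u) K) :=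
  Submodule.liftQ _ (F.d i) (F.range_d_le_ker_d i)

theorem cokerMap_injective (i : ℕ) : Function.Injective (F.cokerMap i) := by
  rw [← LinearMap.ker_eq_bot, cokerMap]
  exact Submodule.ker_liftQ_eq_bot _ _ _ fun x hx => (F.exact_succ i x).1 hx

theorem exact_cokerMap (i : ℕ) :
    Function.Exact (F.cokerMap i) (Submodule.mkQ (LinearMap.range (F.d i))) := by
  rw [LinearMap.exact_iff, Submodule.ker_mkQ, cokerMap, Submodule.range_liftQ]

/-- The zeroth cokernel is the resolved module. -/
def cokerZeroEquiv : F.Coker 0 ≃ₗ[MvPolynomial (Fin u) K] (MvPolynomial (Fin u) K ⧸ I) :=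
  (Submodule.quotEquivOfEq _ _ (LinearMap.exact_iff.1 F.exact_zero).symm).trans
    (F.ε.quotKerEquivOfSurjective F.ε_surjective)

/-- Dimension shifting along the short exact sequence from `Coker (i + 1)` through the free module
`F_i` to `Coker i`. -/
theorem hasProjectiveDimensionLT_coker_iff (i n : ℕ) :
    HasProjectiveDimensionLT (ModuleCat.of (MvPolynomial (Fin u) K) (F.Coker i)) (n + 2) ↔
      HasProjectiveDimensionLT (ModuleCat.of (MvPolynomial (Fin u) K) (F.Coker (i + 1)))
        (n + 1) := by
  let f := ModuleCat.ofHom (F.cokerMap i)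
  let g := ModuleCat.ofHom (Submodule.mkQ (LinearMap.range (F.d i)))
  have hfg : f ≫ g = 0 := by
    refine ModuleCat.hom_ext (LinearMap.ext fun x => ?_)
    exact (F.exact_cokerMap i).apply_apply_eq_zero x
  have hS : (ShortComplex.mk f g hfg).ShortExact :=
    { exact := (ShortComplex.ShortExact.moduleCat_exact_iff_function_exact _).2 (F.exact_cokerMap i)
      mono_f := (ModuleCat.mono_iff_injective _).2 (F.cokerMap_injective i)
      epi_g := (ModuleCat.epi_iff_surjective _).2 (Submodule.mkQ_surjective _) }
  exact hS.hasProjectiveDimensionLT_X₃_iff n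
    ((IsProjective.iff_projective (R := MvPolynomial (Fin u) K)
      (Fin (F.rank i) → MvPolynomial (Fin u) K)).1 inferInstance)

theorem hasProjectiveDimensionLT_coker_zero_iff (i n : ℕ) :
    HasProjectiveDimensionLT (ModuleCat.of (MvPolynomial (Fin u) K) (F.Coker 0)) (n + 1 + i) ↔
      HasProjectiveDimensionLT (ModuleCat.of (MvPolynomial (Fin u) K) (F.Coker i)) (n + 1) := by
  induction i generalizing n with
  | zero => rfl
  | succ i ih =>
    rw [← F.hasProjectiveDimensionLT_coker_iff i n, ← ih (n + 1)]
    have : n + 1 + (i + 1) = n + 1 + 1 + i := by omega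
    rw [this]

theorem irrelevantIdeal_ne_top : irrelevantIdeal K u ≠ ⊤ := by
  rw [Ne, Ideal.eq_top_iff_one, mem_irrelevantIdeal_iff]
  simp

theorem not_surjective_d (i : ℕ) (hi : F.rank i ≠ 0) : ¬ Function.Surjective (F.d i) := by
  intro h
  obtain ⟨y, hy⟩ := h (Pi.single ⟨0, Nat.pos_of_ne_zero hi⟩ 1)
  have := F.minimal i y ⟨0, Nat.pos_of_ne_zero hi⟩
  rw [hy, Pi.single_eq_same] at this
  exact irrelevantIdeal_ne_top ((Ideal.eq_top_iff_one _).2 this)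

/-- A cokernel in the resolution is not projective as long as the next term is nonzero. -/
theorem not_projective_coker (i : ℕ) (hi : F.rank (i + 1) ≠ 0) :
    ¬ Module.Projective (MvPolynomial (Fin u) K) (F.Coker i) := by
  intro hproj
  obtain ⟨s, hs⟩ := Module.projective_lifting_property (Submodule.mkQ (LinearMap.range (F.d i)))
    LinearMap.id (Submodule.mkQ_surjective _)
  -- A section of the quotient map yields a projection `ρ` of `F_i` onto the image of `d i`.
  let ρ : (Fin (F.rank i) → MvPolynomial (Fin u) K) →ₗ[MvPolynomial (Fin u) K]
      (Fin (F.rank i) → MvPolynomial (Fin u) K) :=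
    LinearMap.id - s ∘ₗ Submodule.mkQ (LinearMap.range (F.d i))
  have hρ1 : ∀ x, ρ x ∈ LinearMap.range (F.d i) := by
    intro x
    rw [← Submodule.ker_mkQ (LinearMap.range (F.d i)), LinearMap.mem_ker]
    have := LinearMap.congr_fun hs (Submodule.mkQ (LinearMap.range (F.d i)) x)
    simp only [LinearMap.comp_apply, LinearMap.id_apply] at this
    simp only [ρ, LinearMap.sub_apply, LinearMap.comp_apply, LinearMap.id_apply, map_sub, this,
      sub_self]
  have hρ2 : ∀ x ∈ LinearMap.range (F.d i), ρ x = x := by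
    intro x hx
    rw [← Submodule.ker_mkQ (LinearMap.range (F.d i)), LinearMap.mem_ker] at hx
    simp [ρ, hx]
  -- For `x` in the image, `x = ρ x = ∑ x_l ρ(e_l)`, where `x_l` is in the irrelevant ideal by
  -- minimality and `ρ(e_l)` is again in the image. Each pass gains one power, and Krull's
  -- intersection theorem forces `d i = 0`. Then `d (i + 1)` would be surjective, against
  -- minimality.
  have hpow : ∀ (n : ℕ) (x), x ∈ LinearMap.range (F.d i) → ∀ k, x k ∈ irrelevantIdeal K u ^ n := by
    intro n
    induction n with
    | zero => intro x _ k; simp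
    | succ n ih =>
      intro x hx k
      obtain ⟨y, hy⟩ := hx
      rw [← hρ2 x ⟨y, hy⟩, pi_eq_sum_univ' x, map_sum, Finset.sum_apply]
      refine Ideal.sum_mem _ fun l _ => ?_
      rw [map_smul, Pi.smul_apply, smul_eq_mul, pow_succ']
      exact Ideal.mul_mem_mul (hy ▸ F.minimal i y l) (ih _ (hρ1 _) k)
  have hzero : ∀ x, F.d i x = 0 := by
    intro x
    funext k
    have h1 := Ideal.iInf_pow_eq_bot_of_isDomain (irrelevantIdeal K u) irrelevantIdeal_ne_top
    have h2 : F.d i x k ∈ (⨅ n : ℕ, irrelevantIdeal K u ^ n) :=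
      (Submodule.mem_iInf _).2 fun n => hpow n _ ⟨x, rfl⟩ k
    rw [h1] at h2
    exact h2
  exact F.not_surjective_d (i + 1) hi fun x => (F.exact_succ i x).1 (hzero x)

/-- The projective dimension is the length of a minimal graded free resolution. -/
theorem projectiveDimension_eq (m : ℕ) (hm : F.rank m ≠ 0) (hm' : F.rank (m + 1) = 0) :
    projectiveDimension (ModuleCat.of (MvPolynomial (Fin u) K) (MvPolynomial (Fin u) K ⧸ I)) =
      ((m : ℕ∞) : WithBot ℕ∞) := by
  rw [← projectiveDimension_eq_of_iso F.cokerZeroEquiv.toModuleIso]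
  refine le_antisymm ?_ ?_
  · refine (projectiveDimension_le_iff _ m).2 ?_
    have h := (F.hasProjectiveDimensionLT_coker_zero_iff m 0).2 ?_
    · have hm1 : 0 + 1 + m = m + 1 := by omega
      rwa [hm1] at h
    -- Since `F_{m+1} = 0`, the `m`-th cokernel is the free module `F_m`.
    · have hsub : Subsingleton (Fin (F.rank (m + 1)) → MvPolynomial (Fin u) K) := by
        have : IsEmpty (Fin (F.rank (m + 1))) := by rw [hm']; infer_instance
        infer_instance
      have hbot : LinearMap.range (F.d m) = ⊥ := by
        rw [LinearMap.range_eq_bot]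
        refine LinearMap.ext fun x => ?_
        rw [Subsingleton.elim x 0, map_zero, map_zero]
      have hp : Module.Projective (MvPolynomial (Fin u) K) (F.Coker m) :=
        Module.Projective.of_equiv (Submodule.quotEquivOfEqBot _ hbot).symm
      exact (projective_iff_hasProjectiveDimensionLT_one).1
        ((IsProjective.iff_projective (R := MvPolynomial (Fin u) K) (F.Coker m)).1 hp)
  · refine (projectiveDimension_ge_iff _ m).2 ?_
    intro h
    cases m with
    | zero =>
      have h1 := isZero_of_hasProjectiveDimensionLT_zero (ModuleCat.of (MvPolynomial (Fin u) K)
        (F.Coker 0))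
      have h2 := ModuleCat.subsingleton_of_isZero h1
      have h3 := Submodule.Quotient.subsingleton_iff.1 h2
      exact F.not_surjective_d 0 hm (LinearMap.range_eq_top.1 h3)
    | succ i =>
      have h1 : HasProjectiveDimensionLT (ModuleCat.of (MvPolynomial (Fin u) K) (F.Coker 0))
          (0 + 1 + i) := by
        have : 0 + 1 + i = i + 1 := by omega
        rw [this]
        exact h
      have h2 := (F.hasProjectiveDimensionLT_coker_zero_iff i 0).1 h1
      exact F.not_projective_coker i hm
        ((IsProjective.iff_projective (R := MvPolynomial (Fin u) K) (F.Coker i)).2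
          ((projective_iff_hasProjectiveDimensionLT_one).2 h2))

end MinimalGradedFreeResolution

end

end ModularCode

/-! ### Socles, lengths and irredundant generating systems -/

namespace ModularCode

noncomputable section

section Length

variable {R : Type*} [CommRing R] {E : Type*} [AddCommGroup E] [Module R E]

theorem length_eq_add_of_le {D' D : Submodule R E} (h : D' ≤ D) :
    Module.length R D =
      Module.length R D' + Module.length R (D ⧸ D'.comap D.subtype) := by
  rw [Module.length_eq_add_of_exact (D'.comap D.subtype).subtype (D'.comap D.subtype).mkQ
    (Submodule.subtype_injective _) (Submodule.mkQ_surjective _)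
    (LinearMap.exact_subtype_mkQ _),
    (Submodule.comapSubtypeEquivOfLe h).length_eq]

theorem length_add_one_of_covBy {D' D : Submodule R E} (h : D' ⋖ D) :
    Module.length R D' + 1 = Module.length R D := by
  have := (covBy_iff_quot_is_simple h.le).1 h
  rw [length_eq_add_of_le h.le, Module.length_eq_one R (D ⧸ D'.comap D.subtype)]

theorem exists_disjoint_complement {D D' : Submodule R E} [IsSemisimpleModule R D] (h : D' ≤ D) :
    ∃ T, T ⊔ D' = D ∧ T ⊓ D' = ⊥ := by
  obtain ⟨T, hT⟩ := exists_isCompl (D'.comap D.subtype)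
  have h' : (D'.comap D.subtype).map D.subtype = D' := by
    rw [Submodule.map_comap_subtype, inf_eq_right.2 h]
  refine ⟨T.map D.subtype, ?_, ?_⟩
  · rw [← h', ← Submodule.map_sup, sup_comm, hT.sup_eq_top, Submodule.map_subtype_top]
  · rw [← h', ← Submodule.map_inf _ (Submodule.subtype_injective D), inf_comm, hT.inf_eq_bot,
      Submodule.map_bot]

/-- The elements of a submodule that are annihilated by the Jacobson radical. -/
def socle (D : Submodule R E) : Submodule R E :=
  D ⊓ Submodule.torsionBySet R E (Ring.jacobson R : Set R)

theorem mem_socle {D : Submodule R E} {v : E} :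
    v ∈ socle D ↔ v ∈ D ∧ ∀ r ∈ Ring.jacobson R, r • v = 0 := by
  rw [socle, Submodule.mem_inf, Submodule.mem_torsionBySet_iff]
  simp

theorem socle_le (D : Submodule R E) : socle D ≤ D := inf_le_left

theorem socle_mono {D' D : Submodule R E} (h : D' ≤ D) : socle D' ≤ socle D :=
  inf_le_inf_right _ h

/-- The length of a submodule of finite length, as a natural number. -/
def submoduleLength (D : Submodule R E) : ℕ := (Module.length R D).toNat

theorem submoduleLength_bot : submoduleLength (⊥ : Submodule R E) = 0 := by
  rw [submoduleLength, Module.length_bot, ENat.toNat_zero]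

section FiniteRing

variable [Finite R]

/-- The socle is a module over `R ⧸ Ring.jacobson R`, a semisimple ring because `R` is finite. -/
instance isSemisimpleModule_of_le_socle (D : Submodule R E) : IsSemisimpleModule R (socle D) := by
  have htors : Module.IsTorsionBySet R (socle D) (Ring.jacobson R : Set R) := fun x r =>
    Subtype.ext ((mem_socle.1 x.2).2 r r.2)
  let _ := htors.module
  have : IsScalarTower R (R ⧸ Ring.jacobson R) (socle D) := htors.isScalarTower
  have : IsSemisimpleRing (R ⧸ Ring.jacobson R) := IsSemiprimaryRing.isSemisimpleRing
  have h : IsSemisimpleModule (R ⧸ Ring.jacobson R) (socle D) := inferInstance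
  exact (htors.isSemisimpleModule_iff).1 h

/-- A nonzero element has a nonzero multiple in the socle. -/
theorem exists_smul_mem_socle {D : Submodule R E} {v : E} (hv : v ∈ D) (hv0 : v ≠ 0) :
    ∃ r : R, r • v ∈ socle D ∧ r • v ≠ 0 := by
  classical
  have hnil : ∃ k, ∀ r ∈ Ring.jacobson R ^ k, r • v = 0 := by
    obtain ⟨k, hk⟩ := IsSemiprimaryRing.isNilpotent (R := R)
    refine ⟨k, fun r hr => ?_⟩
    rw [hk] at hr
    rw [(Submodule.mem_bot R).1 hr, zero_smul]
  -- With `k + 1` the least exponent whose power of the nilpotent radical kills `v`, any element of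
  -- the `k`-th power not killing `v` moves it into the socle.
  obtain ⟨k, hk⟩ : ∃ k, Nat.find hnil = k + 1 := by
    refine Nat.exists_eq_succ_of_ne_zero fun h0 => hv0 ?_
    have := Nat.find_spec hnil
    rw [h0] at this
    simpa using this 1 (by simp)
  have h1 := Nat.find_spec hnil
  have h2 := Nat.find_min hnil (m := k) (by omega)
  rw [hk] at h1
  push Not at h2
  obtain ⟨r, hr, hrv⟩ := h2
  refine ⟨r, mem_socle.2 ⟨D.smul_mem r hv, fun s hs => ?_⟩, hrv⟩
  rw [smul_smul]
  exact h1 _ (by rw [pow_succ']; exact Ideal.mul_mem_mul hs hr)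

end FiniteRing

variable [Finite E]

theorem length_ne_top_of_finite (D : Submodule R E) : Module.length R D ≠ ⊤ :=
  Module.length_ne_top

theorem coe_submoduleLength (D : Submodule R E) :
    (submoduleLength D : ℕ∞) = Module.length R D :=
  ENat.natCast_toNat (length_ne_top_of_finite D)

theorem submoduleLength_strictMono : StrictMono (submoduleLength : Submodule R E → ℕ) := by
  intro D' D h
  rw [← Nat.cast_lt (α := ℕ∞), coe_submoduleLength, coe_submoduleLength, Module.length_submodule,
    Module.length_submodule]
  exact Submodule.height_strictMono h

theorem submoduleLength_add_one_of_covBy {D' D : Submodule R E} (h : D' ⋖ D) :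
    submoduleLength D' + 1 = submoduleLength D := by
  rw [← Nat.cast_inj (R := ℕ∞), Nat.cast_add, coe_submoduleLength, coe_submoduleLength,
    Nat.cast_one, length_add_one_of_covBy h]

/-- A semisimple submodule has as many irredundant generators as its length. -/
theorem exists_irredundant_generators (r : ℕ) (D : Submodule R E) [IsSemisimpleModule R D]
    (hD : submoduleLength D = r) :
    ∃ s : Finset E, s.card = r ∧ Submodule.span R (s : Set E) = D ∧
      ∀ t : Finset E, t ⊂ s → Submodule.span R (t : Set E) ≠ D := by
  classical
  induction r generalizing D with
  | zero =>
    refine ⟨∅, rfl, ?_, fun t ht => absurd ht (Finset.not_ssubset_empty t)⟩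
    rw [Finset.coe_empty, Submodule.span_empty]
    by_contra h
    have := submoduleLength_strictMono (bot_lt_iff_ne_bot.2 (Ne.symm h))
    omega
  | succ r ih =>
    have hbot : ⊥ < D := bot_lt_iff_ne_bot.2 (by
      rintro rfl
      rw [submoduleLength_bot] at hD
      omega)
    obtain ⟨D', -, hD'⟩ := exists_le_covBy_of_lt hbot
    obtain ⟨T, hT1, hT2⟩ := exists_disjoint_complement hD'.le
    have : IsSemisimpleModule R D' := IsSemisimpleModule.of_injective (Submodule.inclusion hD'.le)
      (Submodule.inclusion_injective _)
    have hlen := submoduleLength_add_one_of_covBy hD'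
    obtain ⟨s, hs, hsD, hmin⟩ := ih D' (by omega)
    -- The new generator is taken in a complement `T` of the maximal submodule `D'`, so that it
    -- cannot help to generate `D'`: this keeps the old generators irredundant.
    obtain ⟨v, hv, hv0⟩ := Submodule.exists_mem_ne_zero_of_ne_bot (p := T) (by
      rintro rfl
      rw [bot_sup_eq] at hT1
      exact hD'.lt.ne hT1)
    have hvD : v ∈ D := hT1 ▸ Submodule.mem_sup_left hv
    have hvD' : v ∉ D' := fun h => hv0 ((Submodule.mem_bot R).1 (hT2 ▸ ⟨hv, h⟩))
    have hvs : v ∉ s := fun h => hvD' (hsD ▸ Submodule.subset_span h)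
    refine ⟨insert v s, by rw [Finset.card_insert_of_notMem hvs, hs], ?_, ?_⟩
    · rw [Finset.coe_insert, Submodule.span_insert, hsD]
      refine (hD'.eq_or_eq le_sup_right (sup_le ?_ hD'.le)).resolve_left fun h => hvD' ?_
      · exact (Submodule.span_singleton_le_iff_mem _ _).2 hvD
      · exact h ▸ Submodule.mem_sup_left (Submodule.mem_span_singleton_self v)
    · intro t ht htD
      by_cases hvt : v ∈ t
      · obtain ⟨t', hvt', rfl⟩ : ∃ t', v ∉ t' ∧ insert v t' = t :=
          ⟨t.erase v, Finset.notMem_erase v t, Finset.insert_erase hvt⟩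
        have hts : t' ⊂ s := by
          refine ⟨fun x hx => ?_, fun h => ht.2 (Finset.insert_subset_insert v h)⟩
          exact (Finset.mem_insert.1 (ht.1 (Finset.mem_insert_of_mem hx))).resolve_left
            (fun h => hvt' (h ▸ hx))
        refine hmin t' hts (le_antisymm (hsD ▸ Submodule.span_mono hts.1) fun x hx => ?_)
        have hx' : x ∈ Submodule.span R ((insert v t' : Finset E) : Set E) := htD ▸ hD'.le hx
        rw [Finset.coe_insert, Submodule.mem_span_insert] at hx'
        obtain ⟨c, z, hz, rfl⟩ := hx'
        have hzD' : z ∈ D' := hsD ▸ Submodule.span_mono hts.1 hz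
        have hc : c • v ∈ T ⊓ D' := ⟨T.smul_mem c hv, (D'.add_mem_iff_left hzD').1 hx⟩
        rw [hT2, Submodule.mem_bot] at hc
        rwa [hc, zero_add]
      · have : t ⊆ s := fun x hx => (Finset.mem_insert.1 (ht.1 hx)).resolve_left
          (fun h => hvt (h ▸ hx))
        have := Submodule.span_mono (R := R) (Finset.coe_subset.2 this)
        rw [htD, hsD] at this
        exact hD'.lt.not_ge this

/-- The number of irredundant generators is bounded by the length modulo the Jacobson radical. -/
theorem card_le_length_quotient {D : Submodule R E} {s : Finset E}
    (hs : Submodule.span R (s : Set E) = D)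
    (hmin : ∀ t : Finset E, t ⊂ s → Submodule.span R (t : Set E) ≠ D) :
    (s.card : ℕ∞) ≤ Module.length R (D ⧸ (Ring.jacobson R • ⊤ : Submodule R D)) := by
  classical
  have hJ : Ring.jacobson R • D ≤ D := Submodule.smul_le_right
  -- Adding one generator strictly enlarges `span t + JD`. Otherwise `a` lies in `span t + JD`, and
  -- Nakayama shows that `s` without `a` already generates `D`.
  have hstep : ∀ t ⊆ s, submoduleLength (Ring.jacobson R • D) + t.card ≤
      submoduleLength (Submodule.span R (t : Set E) ⊔ Ring.jacobson R • D) := by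
    intro t
    induction t using Finset.induction_on with
    | empty => intro _; simp
    | insert a t ha ih =>
      intro hts
      have hts' := (Finset.insert_subset_iff.1 hts)
      have h1 := ih hts'.2
      rw [Finset.card_insert_of_notMem ha]
      refine lt_of_le_of_lt h1 (submoduleLength_strictMono (lt_of_le_of_ne ?_ fun h => ?_))
      · exact sup_le_sup_right (Submodule.span_mono (by simp)) _
      · have haD : a ∈ Submodule.span R (t : Set E) ⊔ Ring.jacobson R • D := by
          rw [h]
          exact Submodule.mem_sup_left (Submodule.subset_span (by simp))
        have hsub : t ⊆ s.erase a := fun x hx =>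
          Finset.mem_erase.2 ⟨fun h => ha (h ▸ hx), hts'.2 hx⟩
        have hle : D ≤ Submodule.span R ((s.erase a : Finset E) : Set E) ⊔
            Ring.jacobson R • D := by
          conv_lhs => rw [← hs]
          rw [Submodule.span_le]
          intro x hx
          by_cases hxa : x = a
          · subst hxa
            have hle : Submodule.span R (t : Set E) ⊔ Ring.jacobson R • D ≤
                Submodule.span R ((s.erase x : Finset E) : Set E) ⊔ Ring.jacobson R • D :=
              sup_le_sup_right (Submodule.span_mono (Finset.coe_subset.2 hsub)) _
            exact hle haD
          · exact Submodule.mem_sup_left (Submodule.subset_span (by simpa [hxa] using hx))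
        have hnak := Submodule.le_of_le_smul_of_le_jacobson_bot (I := Ring.jacobson R)
          (IsNoetherian.noetherian D) (Ideal.jacobson_bot (R := R)).ge hle
        refine hmin (s.erase a) (Finset.erase_ssubset hts'.1) (le_antisymm ?_ hnak)
        conv_rhs => rw [← hs]
        exact Submodule.span_mono (by simp)
  have h1 := hstep s le_rfl
  rw [hs, sup_eq_left.2 hJ] at h1
  have h2 := length_eq_add_of_le hJ
  have h3 : (Ring.jacobson R • D).comap D.subtype = (Ring.jacobson R • ⊤ : Submodule R D) := by
    apply Submodule.map_injective_of_injective (Submodule.subtype_injective D)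
    rw [Submodule.map_comap_subtype, inf_eq_right.2 hJ, Submodule.map_smul'',
      Submodule.map_subtype_top]
  rw [h3, ← coe_submoduleLength, ← coe_submoduleLength] at h2
  rw [← Nat.cast_le (α := ℕ∞), h2, Nat.cast_add] at h1
  exact (ENat.add_le_add_iff_left (ENat.natCast_ne_top _)).1 h1

/-- For a submodule annihilated by the Jacobson radical, or over a principal ideal ring, the length
modulo the Jacobson radical is the length of the socle. -/
theorem length_quotient_jacobson_eq (D : Submodule R E)
    (hD : (∀ v ∈ D, ∀ r ∈ Ring.jacobson R, r • v = 0) ∨ IsPrincipalIdealRing R) :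
    Module.length R (D ⧸ (Ring.jacobson R • ⊤ : Submodule R D)) =
      Module.length R (socle D) := by
  rcases hD with hD | hR
  · have h1 : socle D = D := le_antisymm (socle_le D) fun v hv => mem_socle.2 ⟨hv, hD v hv⟩
    have h2 : (Ring.jacobson R • ⊤ : Submodule R D) = ⊥ := by
      rw [eq_bot_iff, Submodule.smul_le]
      intro r hr x _
      exact (Submodule.mem_bot R).2 (Subtype.ext (hD x x.2 r hr))
    rw [(Submodule.quotEquivOfEqBot _ h2).length_eq, h1]
  -- If `J = (p)`, then the socle of `D` and `D/JD` are the kernel and the cokernel of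
  -- multiplication by `p` on `D`, and these have the same length.
  · obtain ⟨p, hp⟩ := hR.principal (Ring.jacobson R)
    rw [Ideal.submodule_span_eq] at hp
    let f : D →ₗ[R] D := LinearMap.lsmul R D p
    have h1 : (Ring.jacobson R • ⊤ : Submodule R D) = LinearMap.range f := by
      rw [hp, Submodule.ideal_span_singleton_smul]
      ext x
      simp [f, Submodule.mem_smul_pointwise_iff_exists]
    have h2 : (socle D).comap D.subtype = LinearMap.ker f := by
      ext x
      rw [Submodule.mem_comap, mem_socle, LinearMap.mem_ker, hp]
      simp only [Submodule.subtype_apply, SetLike.coe_mem, true_and, f, LinearMap.lsmul_apply]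
      constructor
      · intro h
        exact Subtype.ext (h p (Ideal.mem_span_singleton_self p))
      · intro h r hr
        obtain ⟨c, rfl⟩ := Ideal.mem_span_singleton'.1 hr
        rw [mul_smul]
        have := congrArg Subtype.val h
        rw [Submodule.coe_smul, Submodule.coe_zero] at this
        rw [this, smul_zero]
    have h3 := Module.length_eq_add_of_exact (LinearMap.ker f).subtype f.rangeRestrict
      (Submodule.subtype_injective _) f.surjective_rangeRestrict
      ((LinearMap.exact_iff).2 (by simp))
    have h4 := Module.length_eq_add_of_exact (LinearMap.range f).subtype (LinearMap.range f).mkQ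
      (Submodule.subtype_injective _) (Submodule.mkQ_surjective _) (LinearMap.exact_subtype_mkQ _)
    rw [h1, ← (Submodule.comapSubtypeEquivOfLe (socle_le D)).length_eq, h2]
    rw [h3, add_comm] at h4
    have h5 := Module.length_ne_top (R := R) (M := LinearMap.range f)
    exact le_antisymm ((ENat.add_le_add_iff_left h5).1 h4.ge)
      ((ENat.add_le_add_iff_left h5).1 h4.le)

end Length

end

end ModularCode

/-! ### `M(C)` as the length of `C` modulo the Jacobson radical -/

namespace ModularCode

noncomputable section

open IsLocalRing

section Localization

theorem jacobson_eq_iInf_maximalSpectrum (R : Type*) [CommRing R] :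
    Ring.jacobson R = ⨅ 𝔪 : MaximalSpectrum R, 𝔪.asIdeal := by
  rw [← Ideal.jacobson_bot, Ideal.jacobson, sInf_eq_iInf']
  refine le_antisymm (le_iInf fun 𝔪 => iInf_le_of_le ⟨𝔪.asIdeal, bot_le, 𝔪.isMaximal⟩ le_rfl)
    (le_iInf fun J => iInf_le_of_le ⟨J.1, J.2.2⟩ le_rfl)

variable {R : Type*} [CommRing R] {n : ℕ} (C : Submodule R (Fin n → R))
  (𝔪 : MaximalSpectrum R)

/-- The projection of a code to its component at a maximal ideal. -/
def toComponent : C →ₗ[R] component C 𝔪 where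
  toFun v := ⟨fun i => algebraMap R (Localization.AtPrime 𝔪.asIdeal) (v.1 i),
    Submodule.subset_span ⟨v, v.2, rfl⟩⟩
  map_add' v w := Subtype.ext (funext fun i => map_add _ _ _)
  map_smul' r v := Subtype.ext (funext fun i => by
    simp [Algebra.smul_def])

theorem exists_notMem_smul_eq_zero {v : C} (hv : toComponent C 𝔪 v = 0) :
    ∃ s ∉ 𝔪.asIdeal, s • v = 0 := by
  have h : ∀ i, ∃ s : 𝔪.asIdeal.primeCompl, (s : R) * v.1 i = 0 := fun i => by
    have := congrFun (congrArg Subtype.val hv) i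
    exact (IsLocalization.map_eq_zero_iff 𝔪.asIdeal.primeCompl
      (Localization.AtPrime 𝔪.asIdeal) _).1 this
  choose s hs using h
  refine ⟨((∏ i, s i : 𝔪.asIdeal.primeCompl) : R), (∏ i, s i).2, Subtype.ext (funext fun i => ?_)⟩
  rw [← Finset.mul_prod_erase _ _ (Finset.mem_univ i)]
  change _ * v.1 i = 0
  rw [Submonoid.coe_mul, mul_right_comm, hs, zero_mul]

variable [Finite R]

theorem algebraMap_localization_surjective :
    Function.Surjective (algebraMap R (Localization.AtPrime 𝔪.asIdeal)) :=
  IsArtinianRing.localization_surjective 𝔪.asIdeal.primeCompl _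

theorem toComponent_surjective : Function.Surjective (toComponent C 𝔪) := by
  rintro ⟨w, hw⟩
  suffices h : ∃ v ∈ C, ∀ i, algebraMap R (Localization.AtPrime 𝔪.asIdeal) (v i) = w i by
    obtain ⟨v, hv, h⟩ := h
    exact ⟨⟨v, hv⟩, Subtype.ext (funext h)⟩
  induction hw using Submodule.span_induction with
  | mem x hx =>
    obtain ⟨v, hv, rfl⟩ := hx
    exact ⟨v, hv, fun _ => rfl⟩
  | zero => exact ⟨0, zero_mem _, fun i => by simp⟩
  | add x y _ _ hx hy =>
    obtain ⟨v, hv, h1⟩ := hx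
    obtain ⟨w, hw, h2⟩ := hy
    exact ⟨v + w, add_mem hv hw, fun i => by simp [h1, h2]⟩
  | smul c x _ hx =>
    obtain ⟨v, hv, h1⟩ := hx
    obtain ⟨r, rfl⟩ := algebraMap_localization_surjective 𝔪 c
    exact ⟨r • v, C.smul_mem r hv, fun i => by simp [h1]⟩

/-- The reduction of the component at a maximal ideal. -/
abbrev ComponentReduction : Type _ :=
  component C 𝔪 ⧸ (maximalIdeal (Localization.AtPrime 𝔪.asIdeal) •
    ⊤ : Submodule (Localization.AtPrime 𝔪.asIdeal) (component C 𝔪))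

/-- The projection of a code to the reduction of its component. -/
def toComponentReduction : C →ₗ[R] ComponentReduction C 𝔪 :=
  (Submodule.mkQ (maximalIdeal (Localization.AtPrime 𝔪.asIdeal) •
    ⊤ : Submodule (Localization.AtPrime 𝔪.asIdeal) (component C 𝔪))).restrictScalars R ∘ₗ
    toComponent C 𝔪

theorem toComponentReduction_surjective : Function.Surjective (toComponentReduction C 𝔪) :=
  (Submodule.mkQ_surjective _).comp (toComponent_surjective C 𝔪)

/-- An element `v` of the kernel has the same component as some `w` in `𝔪C`, so `v - w` is killed by
some `s ∉ 𝔪`. As `s` is invertible modulo `𝔪`, `v - w` is a multiple of itself by an element of `𝔪`.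
-/
theorem ker_toComponentReduction :
    LinearMap.ker (toComponentReduction C 𝔪) = (𝔪.asIdeal • ⊤ : Submodule R C) := by
  apply le_antisymm
  · intro v hv
    have hv' : toComponent C 𝔪 v ∈ (maximalIdeal (Localization.AtPrime 𝔪.asIdeal) •
        ⊤ : Submodule (Localization.AtPrime 𝔪.asIdeal) (component C 𝔪)) :=
      (Submodule.Quotient.mk_eq_zero _).1 hv
    have hlift : ∀ y ∈ (maximalIdeal (Localization.AtPrime 𝔪.asIdeal) •
        ⊤ : Submodule (Localization.AtPrime 𝔪.asIdeal) (component C 𝔪)),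
        ∃ w ∈ (𝔪.asIdeal • ⊤ : Submodule R C), toComponent C 𝔪 w = y := by
      intro y hy
      refine Submodule.smul_induction_on hy ?_ ?_
      · intro r hr x _
        obtain ⟨a, rfl⟩ := algebraMap_localization_surjective 𝔪 r
        obtain ⟨c, rfl⟩ := toComponent_surjective C 𝔪 x
        rw [IsLocalization.AtPrime.to_map_mem_maximal_iff _ 𝔪.asIdeal] at hr
        exact ⟨a • c, Submodule.smul_mem_smul hr trivial, by rw [map_smul, algebraMap_smul]⟩
      · rintro x y ⟨v, hv, rfl⟩ ⟨w, hw, rfl⟩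
        exact ⟨v + w, add_mem hv hw, map_add _ _ _⟩
    obtain ⟨w, hw, hwv⟩ := hlift _ hv'
    obtain ⟨s, hs, hsv⟩ := exists_notMem_smul_eq_zero C 𝔪 (v := v - w)
      (by rw [map_sub, hwv, sub_self])
    obtain ⟨x, m, hm, hx⟩ := 𝔪.isMaximal.exists_inv hs
    have h1 : v - w = m • (v - w) := by
      conv_lhs => rw [← one_smul R (v - w), ← hx, add_smul, mul_smul, hsv, smul_zero, zero_add]
    rw [← sub_add_cancel v w, h1]
    exact add_mem (Submodule.smul_mem_smul hm trivial) hw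
  · rw [Submodule.smul_le]
    intro r hr v _
    rw [LinearMap.mem_ker]
    refine (Submodule.Quotient.mk_eq_zero _).2 ?_
    rw [map_smul, ← algebraMap_smul (Localization.AtPrime 𝔪.asIdeal) r]
    exact Submodule.smul_mem_smul
      ((IsLocalization.AtPrime.to_map_mem_maximal_iff _ 𝔪.asIdeal r).2 hr) trivial

/-- By Nakayama over the local ring, the number of generators is the dimension of the reduction over
the residue field. Length is unchanged along the surjections from `R` to its localization
(surjective because `R` is finite) and on to the residue field. -/
theorem spanFinrank_component :
    ((component C 𝔪).spanFinrank : ℕ∞) =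
      Module.length R (C ⧸ (𝔪.asIdeal • ⊤ : Submodule R C)) := by
  have hA : Finite (Localization.AtPrime 𝔪.asIdeal) :=
    Finite.of_surjective _ (algebraMap_localization_surjective 𝔪)
  rw [IsLocalRing.spanFinrank_eq_finrank_quotient _ (IsNoetherian.noetherian _)]
  let _ : Field (Localization.AtPrime 𝔪.asIdeal ⧸ maximalIdeal (Localization.AtPrime 𝔪.asIdeal)) :=
    Ideal.Quotient.field _
  have h1 : Module.length (Localization.AtPrime 𝔪.asIdeal) (ComponentReduction C 𝔪) =
      Module.length (Localization.AtPrime 𝔪.asIdeal ⧸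
        maximalIdeal (Localization.AtPrime 𝔪.asIdeal)) (ComponentReduction C 𝔪) :=
    Module.length_eq_of_surjective Ideal.Quotient.mk_surjective
  have h2 : Module.length R (ComponentReduction C 𝔪) =
      Module.length (Localization.AtPrime 𝔪.asIdeal) (ComponentReduction C 𝔪) :=
    Module.length_eq_of_surjective (algebraMap_localization_surjective 𝔪)
  rw [← ker_toComponentReduction, ((toComponentReduction C 𝔪).quotKerEquivOfSurjective
    (toComponentReduction_surjective C 𝔪)).length_eq, h2, h1]
  exact (Module.length_eq_finrank _ _).symm

/-- The number `M(C)` is the length of `C` modulo the Jacobson radical. -/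
theorem coe_M_eq_length :
    (M C : ℕ∞) = Module.length R (C ⧸ (Ring.jacobson R • ⊤ : Submodule R C)) := by
  classical
  have hfin : Finite (MaximalSpectrum R) := inferInstance
  let _ := Fintype.ofFinite (MaximalSpectrum R)
  have hI : Pairwise fun 𝔪 𝔫 : MaximalSpectrum R => IsCoprime 𝔪.asIdeal 𝔫.asIdeal :=
    fun 𝔪 𝔫 h => Ideal.isCoprime_of_isMaximal fun h' => h (MaximalSpectrum.ext h')
  -- Chinese remainder theorem: `C/JC` is the product of the quotients `C/𝔪C`.
  have h1 := Ideal.pi_tensorProductMk_quotient_surjective C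
    (fun 𝔪 : MaximalSpectrum R => 𝔪.asIdeal) hI
  have h2 := Ideal.ker_tensorProductMk_quotient C (fun 𝔪 : MaximalSpectrum R => 𝔪.asIdeal) hI
  rw [M, finsum_eq_sum_of_fintype, Nat.cast_sum, jacobson_eq_iInf_maximalSpectrum, ← h2,
    (LinearMap.quotKerEquivOfSurjective _ h1).length_eq, Module.length_pi_of_fintype]
  refine Finset.sum_congr rfl fun 𝔪 _ => ?_
  rw [spanFinrank_component, (TensorProduct.quotTensorEquivQuotSMul C 𝔪.asIdeal).length_eq]

end Localization

end

end ModularCode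

/-! ### The flats of a code -/

namespace ModularCode

noncomputable section

section Flats

variable {R : Type*} [CommRing R] {n u : ℕ} {σ : (Fin n → R) → (Fin u → ℕ)}

/-- The elements of the socle of a code whose support is bounded by `a`. -/
def boundedSubcode (hσ : IsSupport σ) (C : Submodule R (Fin n → R)) (a : Fin u → ℕ) :
    Submodule R (Fin n → R) where
  carrier := {v | v ∈ socle C ∧ σ v ≤ a}
  zero_mem' := ⟨zero_mem _, by rw [(hσ.eq_zero_iff 0).2 rfl]; exact zero_le⟩
  add_mem' := fun ⟨h1, h2⟩ ⟨h3, h4⟩ => ⟨add_mem h1 h3, (hσ.add_le _ _).trans (sup_le h2 h4)⟩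
  smul_mem' := fun r _ ⟨h1, h2⟩ => ⟨Submodule.smul_mem _ r h1, (hσ.smul_le r _).trans h2⟩

theorem mem_boundedSubcode {hσ : IsSupport σ} {C : Submodule R (Fin n → R)} {a : Fin u → ℕ}
    {v : Fin n → R} : v ∈ boundedSubcode hσ C a ↔ v ∈ socle C ∧ σ v ≤ a :=
  Iff.rfl

/-- The subcodes of the socle that are cut out by a bound on the support. -/
def Flat (hσ : IsSupport σ) (C : Submodule R (Fin n → R)) : Type _ :=
  {V : Submodule R (Fin n → R) // ∃ a, boundedSubcode hσ C a = V}

theorem Flat.coe_le_socle {hσ : IsSupport σ} {C : Submodule R (Fin n → R)}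
    (V : Flat hσ C) : V.1 ≤ socle C := by
  obtain ⟨_, a, rfl⟩ := V
  exact fun v hv => hv.1

namespace Flat

variable {hσ : IsSupport σ} {C : Submodule R (Fin n → R)}

instance : SemilatticeInf (Flat hσ C) :=
  Subtype.semilatticeInf (by
    rintro _ _ ⟨a, rfl⟩ ⟨b, rfl⟩
    refine ⟨a ⊓ b, ?_⟩
    ext v
    simp only [mem_boundedSubcode, Submodule.mem_inf, le_inf_iff]
    tauto)

instance : OrderBot (Flat hσ C) where
  bot := ⟨⊥, 0, by
    ext v
    rw [mem_boundedSubcode, Submodule.mem_bot, ← hσ.eq_zero_iff]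
    refine ⟨fun h => le_antisymm h.2 zero_le, fun h => ⟨?_, h.le⟩⟩
    rw [(hσ.eq_zero_iff v).1 h]
    exact zero_mem _⟩
  bot_le V := (bot_le : ⊥ ≤ V.1)

theorem le_iff {V W : Flat hσ C} : V ≤ W ↔ V.1 ≤ W.1 := Iff.rfl

theorem lt_iff {V W : Flat hσ C} : V < W ↔ V.1 < W.1 := Iff.rfl

theorem coe_bot : (⊥ : Flat hσ C).1 = ⊥ := rfl

end Flat

variable [Finite R]

theorem codeSupport_le_iff {D : Submodule R (Fin n → R)} {a : Fin u → ℕ} :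
    codeSupport σ D ≤ a ↔ ∀ v ∈ D, σ v ≤ a := by
  simp [codeSupport, Finset.sup_le_iff]

theorem le_codeSupport {D : Submodule R (Fin n → R)} {v : Fin n → R} (hv : v ∈ D) :
    σ v ≤ codeSupport σ D :=
  codeSupport_le_iff.1 le_rfl v hv

theorem codeSupport_mono {D' D : Submodule R (Fin n → R)} (h : D' ≤ D) :
    codeSupport σ D' ≤ codeSupport σ D :=
  codeSupport_le_iff.2 fun _ hv => le_codeSupport (h hv)

namespace Flat

variable {hσ : IsSupport σ} {C : Submodule R (Fin n → R)}

instance : Finite (Flat hσ C) := Subtype.finite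

/-- The flat of the elements with support bounded by `a`. -/
def mk (hσ : IsSupport σ) (C : Submodule R (Fin n → R)) (a : Fin u → ℕ) : Flat hσ C :=
  ⟨boundedSubcode hσ C a, a, rfl⟩

theorem le_mk_iff {V : Flat hσ C} {a : Fin u → ℕ} : V ≤ mk hσ C a ↔ codeSupport σ V.1 ≤ a := by
  rw [codeSupport_le_iff]
  exact ⟨fun h v hv => (h hv).2, fun h v hv => ⟨V.coe_le_socle hv, h v hv⟩⟩

/-- A flat is thus determined by its support, which makes the multidegree strictly monotone. -/
theorem mk_codeSupport (V : Flat hσ C) : mk hσ C (codeSupport σ V.1) = V := by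
  refine le_antisymm ?_ (le_mk_iff.2 le_rfl)
  obtain ⟨_, a, rfl⟩ := V
  exact fun v hv => ⟨hv.1, hv.2.trans (codeSupport_le_iff.2 fun w hw => hw.2)⟩

/-- The multidegree of a flat. -/
def deg (V : Flat hσ C) : Fin u →₀ ℕ := Finsupp.equivFunOnFinite.symm (codeSupport σ V.1)

theorem deg_le_iff {V : Flat hσ C} {a : Fin u →₀ ℕ} : V.deg ≤ a ↔ V ≤ mk hσ C a :=
  le_mk_iff.symm

theorem degree_deg (V : Flat hσ C) : V.deg.degree = ∑ i, codeSupport σ V.1 i :=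
  Finsupp.degree_eq_sum _

theorem deg_strictMono : StrictMono (deg : Flat hσ C → Fin u →₀ ℕ) := by
  intro V W h
  refine lt_of_le_of_ne (codeSupport_mono h.le : codeSupport σ V.1 ≤ codeSupport σ W.1)
    fun h' => h.ne ?_
  rw [← mk_codeSupport V, ← mk_codeSupport W]
  exact congrArg _ (Finsupp.equivFunOnFinite.symm.injective h')

theorem deg_bot : (⊥ : Flat hσ C).deg = 0 := by
  have : codeSupport σ (⊥ : Flat hσ C).1 ≤ 0 := codeSupport_le_iff.2 fun v hv => by
    rw [coe_bot, Submodule.mem_bot] at hv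
    rw [hv, (hσ.eq_zero_iff 0).2 rfl]
  ext i
  exact Nat.le_zero.1 (this i)

/-- The rank of a flat is its length. -/
def rk (V : Flat hσ C) : ℕ := submoduleLength V.1

theorem rk_strictMono : StrictMono (rk : Flat hσ C → ℕ) :=
  fun _ _ h => submoduleLength_strictMono h

/-- The whole socle, as a flat. -/
def whole (hσ : IsSupport σ) (C : Submodule R (Fin n → R)) : Flat hσ C :=
  mk hσ C (codeSupport σ (socle C))

theorem coe_whole : (whole hσ C).1 = socle C :=
  le_antisymm (whole hσ C).coe_le_socle fun _ hv => ⟨hv, le_codeSupport hv⟩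

theorem le_whole (V : Flat hσ C) : V ≤ whole hσ C := by
  rw [le_iff, coe_whole]
  exact V.coe_le_socle

/-- The flat of the elements of the socle that vanish at the coordinate `i`. -/
def hyperplane (hσ : IsSupport σ) (C : Submodule R (Fin n → R)) (i : Fin u) : Flat hσ C :=
  mk hσ C (Function.update (codeSupport σ (socle C)) i 0)

theorem mem_hyperplane {i : Fin u} {v : Fin n → R} :
    v ∈ (hyperplane hσ C i).1 ↔ v ∈ socle C ∧ σ v i = 0 := by
  change v ∈ socle C ∧ σ v ≤ _ ↔ _
  refine and_congr_right fun hv => ⟨fun h => by simpa using h i, fun h j => ?_⟩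
  by_cases hj : j = i
  · subst hj; simp [h]
  · rw [Function.update_of_ne hj]
    exact le_codeSupport hv j

end Flat

/-- On the socle, a modular support takes at most one nonzero value at each coordinate. -/
theorem IsModularSupport.eq_of_mem_socle (hσ : IsModularSupport σ) {C : Submodule R (Fin n → R)}
    {i : Fin u} {v w : Fin n → R} (hv : v ∈ socle C) (hw : w ∈ socle C) (hv0 : σ v i ≠ 0)
    (hw0 : σ w i ≠ 0) : σ v i = σ w i := by
  let H : Submodule R (Fin n → R) := (Flat.hyperplane hσ.toIsSupport C i).1
  have hH : ∀ x, x ∈ H ↔ x ∈ socle C ∧ σ x i = 0 := fun x => Flat.mem_hyperplane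
  -- With `m` of least nonzero value at `i`, modularity lets any `x ∉ H` push `m` into `H`, since a
  -- smaller value can only be `0`.
  obtain ⟨m, ⟨hm, hm0⟩, hmin⟩ := Set.exists_min_image {x | x ∈ socle C ∧ σ x i ≠ 0}
    (fun x => σ x i) (Set.toFinite _) ⟨v, hv, hv0⟩
  have hred : ∀ x ∈ socle C, x ∉ H → ∃ r : R, m + r • x ∈ H := fun x hx hxH => by
    have hx0 : σ x i ≠ 0 := fun h => hxH ((hH x).2 ⟨hx, h⟩)
    obtain ⟨r, hr⟩ := hσ.modular m x i hm0 (hmin x ⟨hx, hx0⟩)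
    have hmem : m + r • x ∈ socle C := add_mem hm (Submodule.smul_mem _ r hx)
    refine ⟨r, (hH _).2 ⟨hmem, ?_⟩⟩
    by_contra h
    exact absurd (hmin _ ⟨hmem, h⟩) (not_le.2 hr)
  have hle : Submodule.span R {m} ⊔ H ≤ socle C :=
    sup_le ((Submodule.span_singleton_le_iff_mem _ _).2 hm) fun x hx => ((hH x).1 hx).1
  obtain ⟨T, hT1, hT2⟩ := exists_disjoint_complement hle
  -- A nonzero `x` in the complement `T` would give `m + r x ∈ H`, hence `r x ∈ T ⊓ (span {m} ⊔ H) =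
  -- ⊥` and `m ∈ H`. So `m` and `H` generate the socle, and the value at `i` of any element is at
  -- most that of `m`.
  have hT : T = ⊥ := by
    rw [eq_bot_iff]
    intro x hx
    rw [Submodule.mem_bot]
    by_contra hx0
    have hxH : x ∉ H := fun h => hx0 ((Submodule.mem_bot R).1
      (hT2 ▸ Submodule.mem_inf.2 ⟨hx, Submodule.mem_sup_right h⟩))
    obtain ⟨r, hr⟩ := hred x (hT1 ▸ Submodule.mem_sup_left hx) hxH
    have h1 : r • x ∈ Submodule.span R {m} ⊔ H := by
      have h2 : m ∈ Submodule.span R {m} ⊔ H :=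
        Submodule.mem_sup_left (Submodule.mem_span_singleton_self m)
      exact (Submodule.add_mem_iff_right _ h2).1 (Submodule.mem_sup_right hr)
    have h3 : r • x ∈ T ⊓ (Submodule.span R {m} ⊔ H) := ⟨T.smul_mem r hx, h1⟩
    rw [hT2, Submodule.mem_bot] at h3
    rw [h3, add_zero] at hr
    exact hm0 ((hH m).1 hr).2
  rw [hT, bot_sup_eq] at hT1
  have hval : ∀ x ∈ socle C, σ x i ≠ 0 → σ x i = σ m i := fun x hx hx0 => by
    refine le_antisymm ?_ (hmin x ⟨hx, hx0⟩)
    rw [← hT1] at hx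
    obtain ⟨y, hy, z, hz, rfl⟩ := Submodule.mem_sup.1 hx
    obtain ⟨r, rfl⟩ := Submodule.mem_span_singleton.1 hy
    refine (hσ.add_le _ _ i).trans (sup_le (hσ.smul_le r m i) ?_)
    rw [((hH z).1 hz).2]
    exact Nat.zero_le _
  rw [hval v hv hv0, hval w hw hw0]

namespace Flat

variable {C : Submodule R (Fin n → R)}

/-- Let `w` in an intermediate `U` be nonzero at `i`. Any `x ∈ V` nonzero at `i` has the same value
there, so modularity gives `x + r w` of smaller value, that is `0`. Hence `x ∈ U`. -/
theorem inf_hyperplane_covBy (hσ : IsModularSupport σ) {V : Flat hσ.toIsSupport C} {i : Fin u}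
    (h : ¬ V ≤ hyperplane hσ.toIsSupport C i) : (V ⊓ hyperplane hσ.toIsSupport C i).1 ⋖ V.1 := by
  refine ⟨lt_of_le_of_ne inf_le_left fun h' => h (le_iff.2 (inf_eq_left.1 h')), ?_⟩
  intro U hU hUV
  obtain ⟨w, hw, hwH⟩ := SetLike.exists_of_lt hU
  have hws : w ∈ socle C := V.coe_le_socle (hUV.le hw)
  have hw0 : σ w i ≠ 0 := fun h0 => hwH ⟨hUV.le hw, mem_hyperplane.2 ⟨hws, h0⟩⟩
  refine hUV.not_ge fun x hx => ?_
  have hxs := V.coe_le_socle hx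
  by_cases hx0 : σ x i = 0
  · exact hU.le ⟨hx, mem_hyperplane.2 ⟨hxs, hx0⟩⟩
  · have heq := hσ.eq_of_mem_socle hxs hws hx0 hw0
    obtain ⟨r, hr⟩ := hσ.modular x w i hx0 heq.le
    have hmem : x + r • w ∈ socle C := add_mem hxs (Submodule.smul_mem _ r hws)
    have h0 : σ (x + r • w) i = 0 := by
      by_contra h0
      rw [hσ.eq_of_mem_socle hmem hxs h0 hx0] at hr
      exact lt_irrefl _ hr
    have hU' : x + r • w ∈ U := hU.le
      ⟨add_mem hx (Submodule.smul_mem _ r (hUV.le hw)), mem_hyperplane.2 ⟨hmem, h0⟩⟩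
    exact (Submodule.add_mem_iff_left _ (Submodule.smul_mem _ r hw)).1 hU'

theorem rk_inf_hyperplane (hσ : IsModularSupport σ) {V : Flat hσ.toIsSupport C} {i : Fin u}
    (h : ¬ V ≤ hyperplane hσ.toIsSupport C i) :
    (V ⊓ hyperplane hσ.toIsSupport C i).rk + 1 = V.rk :=
  submoduleLength_add_one_of_covBy (inf_hyperplane_covBy hσ h)

/-- Some `v ∈ V` exceeds the support of `D` at a coordinate `i`. As only one nonzero value is
possible there, all of `D` vanishes at `i`. -/
theorem exists_le_inf_hyperplane (hσ : IsModularSupport σ) {D V : Flat hσ.toIsSupport C}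
    (h : D < V) : ∃ i, ¬ V ≤ hyperplane hσ.toIsSupport C i ∧
      D ≤ V ⊓ hyperplane hσ.toIsSupport C i := by
  obtain ⟨v, hv, hvD⟩ := SetLike.exists_of_lt (lt_iff.1 h)
  have hvs := V.coe_le_socle hv
  obtain ⟨i, hi⟩ : ∃ i, codeSupport σ D.1 i < σ v i := by
    by_contra! hle
    rw [← mk_codeSupport D] at hvD
    exact hvD ⟨hvs, hle⟩
  refine ⟨i, fun hV => ?_, le_inf h.le fun w hw => ?_⟩
  · have := (mem_hyperplane.1 (hV hv)).2
    omega
  · have hws := D.coe_le_socle hw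
    refine mem_hyperplane.2 ⟨hws, ?_⟩
    by_contra h0
    have h1 := hσ.eq_of_mem_socle hws hvs h0 (by omega)
    have h2 : σ w i ≤ codeSupport σ D.1 i := le_codeSupport hw i
    omega

theorem exists_eq_inf_hyperplane (hσ : IsModularSupport σ) {X V : Flat hσ.toIsSupport C}
    (h : X ≤ V) (hr : X.rk + 1 = V.rk) : ∃ i, ¬ V ≤ hyperplane hσ.toIsSupport C i ∧
      X = V ⊓ hyperplane hσ.toIsSupport C i := by
  obtain ⟨i, h1, h2⟩ := exists_le_inf_hyperplane hσ (lt_of_le_of_ne h (by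
    rintro rfl
    omega))
  refine ⟨i, h1, (lt_or_eq_of_le h2).resolve_left fun h3 => ?_⟩
  have h4 := rk_strictMono h3
  have h5 := rk_inf_hyperplane hσ h1
  omega

theorem eq_of_le_of_rk_eq {hσ : IsSupport σ} {X Y : Flat hσ C} (h : X ≤ Y) (hr : X.rk = Y.rk) :
    X = Y :=
  (lt_or_eq_of_le h).resolve_left fun h' => (rk_strictMono h').ne hr

/-- All coatoms of `V` are sections `V ⊓ H_i` by hyperplanes, and sectioning drops the rank by at
most one. A second coatom `V ⊓ H_j` meets `X` in `X ⊓ H_j`; and for `Z = X ⊓ H_i`, the flat `V ⊓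
H_i` is the other coatom required by thickness. -/
theorem isCogeometricRank (hσ : IsModularSupport σ) (C : Submodule R (Fin n → R)) :
    IsCogeometricRank (rk : Flat hσ.toIsSupport C → ℕ) where
  bot := submoduleLength_bot
  strictMono := rk_strictMono
  exists_coatom D V h := by
    obtain ⟨i, h1, h2⟩ := exists_le_inf_hyperplane hσ h
    exact ⟨_, h2, inf_le_left, rk_inf_hyperplane hσ h1⟩
  inf_coatom V X Y hX hY hXr hYr hne := by
    obtain ⟨j, hj, rfl⟩ := exists_eq_inf_hyperplane hσ hY hYr
    have h : X ⊓ (V ⊓ hyperplane hσ.toIsSupport C j) = X ⊓ hyperplane hσ.toIsSupport C j := by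
      rw [← inf_assoc, inf_eq_left.2 hX]
    rw [h]
    exact rk_inf_hyperplane hσ fun hXj => hne (eq_of_le_of_rk_eq (le_inf hX hXj) (by omega))
  thick V X Z hX hXr hZ hZr := by
    obtain ⟨i, hi, rfl⟩ := exists_eq_inf_hyperplane hσ hZ hZr
    have hV : ¬ V ≤ hyperplane hσ.toIsSupport C i := fun h => hi (hX.trans h)
    refine ⟨V ⊓ hyperplane hσ.toIsSupport C i, inf_le_left, rk_inf_hyperplane hσ hV, ?_,
      inf_le_inf_right _ hX⟩
    rintro rfl
    exact hi inf_le_right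

/-- Below a flat there are flats of every smaller rank. -/
theorem exists_le_rk_eq (hσ : IsModularSupport σ) (r : ℕ) (V : Flat hσ.toIsSupport C)
    (h : r ≤ V.rk) : ∃ D ≤ V, D.rk = r := by
  induction hm : V.rk - r generalizing V with
  | zero => exact ⟨V, le_rfl, by omega⟩
  | succ m ih =>
    have hV : (⊥ : Flat hσ.toIsSupport C) < V := bot_lt_iff_ne_bot.2 (by
      rintro rfl
      rw [(isCogeometricRank hσ C).bot] at hm
      omega)
    obtain ⟨X, -, hX, hXr⟩ := (isCogeometricRank hσ C).exists_coatom ⊥ V hV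
    obtain ⟨D, hD, hDr⟩ := ih X (by omega) (by omega)
    exact ⟨D, hD.trans hX, hDr⟩

end Flat

end Flats

section CodeIdeal

open MvPolynomial

variable {R : Type*} [CommRing R] {K : Type*} [Field K] {n u : ℕ}
  {σ : (Fin n → R) → (Fin u → ℕ)}

theorem mem_codeIdeal_iff (C : Submodule R (Fin n → R)) (f : MvPolynomial (Fin u) K) :
    f ∈ codeIdeal K σ C ↔ ∀ a ∈ f.support, ∃ v ∈ C, v ≠ 0 ∧ σ v ≤ a := by
  have h : codeIdeal K σ C = Ideal.span ((fun s => monomial s (1 : K)) ''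
      {s | ∃ v ∈ C, v ≠ 0 ∧ Finsupp.equivFunOnFinite.symm (σ v) = s}) := by
    rw [codeIdeal]
    congr 1
    ext m
    constructor
    · rintro ⟨v, hv, hv0, rfl⟩
      exact ⟨_, ⟨v, hv, hv0, rfl⟩, rfl⟩
    · rintro ⟨_, ⟨v, hv, hv0, rfl⟩, rfl⟩
      exact ⟨v, hv, hv0, rfl⟩
  rw [h, mem_ideal_span_monomial_image]
  refine forall₂_congr fun a _ => ⟨?_, ?_⟩
  · rintro ⟨_, ⟨v, hv, hv0, rfl⟩, hle⟩
    exact ⟨v, hv, hv0, hle⟩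
  · rintro ⟨v, hv, hv0, hle⟩
    exact ⟨_, ⟨v, hv, hv0, rfl⟩, hle⟩

theorem degreePart_mem_codeIdeal (C : Submodule R (Fin n → R)) :
    ∀ f ∈ codeIdeal K σ C, ∀ t : ℤ, degreePart t f ∈ codeIdeal K σ C := by
  intro f hf t
  rw [mem_codeIdeal_iff] at hf ⊢
  intro a ha
  rw [support_weightedHomogeneousComponent, Finset.mem_filter] at ha
  exact hf a ha.1

/-- A nonzero codeword with support at most `a` has a nonzero multiple in the socle, still with
support at most `a`. This is why the socle alone determines `I_C`. -/
theorem mem_codeIdeal_iff_flat [Finite R] (hσ : IsSupport σ) (C : Submodule R (Fin n → R))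
    (f : MvPolynomial (Fin u) K) :
    f ∈ codeIdeal K σ C ↔ ∀ a ∈ f.support, Flat.mk hσ C a ≠ ⊥ := by
  rw [mem_codeIdeal_iff]
  refine forall₂_congr fun a _ => ⟨?_, ?_⟩
  · rintro ⟨v, hv, hv0, hle⟩ hbot
    obtain ⟨r, hr, hr0⟩ := exists_smul_mem_socle hv hv0
    have h1 : r • v ∈ (Flat.mk hσ C a).1 := ⟨hr, (hσ.smul_le r v).trans hle⟩
    rw [hbot, Flat.coe_bot] at h1
    exact hr0 ((Submodule.mem_bot R).1 h1)
  · intro hbot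
    obtain ⟨v, hv, hv0⟩ := Submodule.exists_mem_ne_zero_of_ne_bot (p := (Flat.mk hσ C a).1)
      fun h => hbot (Subtype.ext h)
    exact ⟨v, socle_le C hv.1, hv0, hv.2⟩

end CodeIdeal

/-! ### Generalized weights as degrees of flats, and the theorem -/

section Weights

variable {R : Type*} [CommRing R] [Finite R] {n u : ℕ} {σ : (Fin n → R) → (Fin u → ℕ)}
  {C : Submodule R (Fin n → R)}

theorem M_eq_rk_whole (hσ : IsSupport σ)
    (hC : (∀ v ∈ C, ∀ r ∈ Ring.jacobson R, r • v = 0) ∨ IsPrincipalIdealRing R) :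
    M C = (Flat.whole hσ C).rk := by
  rw [← Nat.cast_inj (R := ℕ∞), coe_M_eq_length, length_quotient_jacobson_eq C hC, Flat.rk,
    coe_submoduleLength, Flat.coe_whole]

/-- The generalized weights are the least degrees of the flats of given rank. -/
theorem isLeast_generalizedWeight (hσ : IsModularSupport σ)
    (hC : (∀ v ∈ C, ∀ r ∈ Ring.jacobson R, r • v = 0) ∨ IsPrincipalIdealRing R) (r : ℕ)
    (hr : r ≤ M C) :
    IsLeast {t : ℤ | ∃ D : Flat hσ.toIsSupport C, D.rk = r ∧ (D.deg.degree : ℤ) = t}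
      (generalizedWeight σ C r : ℤ) := by
  have h1 : ∀ D : Flat hσ.toIsSupport C, D.rk = r → D.deg.degree ∈
      {w : ℕ | ∃ D : Submodule R (Fin n → R), D ≤ C ∧ (∃ j, r ≤ j ∧ HasMinimalGenerators D j) ∧
        w = ∑ i, codeSupport σ D i} := by
    intro D hD
    have : IsSemisimpleModule R D.1 := IsSemisimpleModule.of_injective
      (Submodule.inclusion D.coe_le_socle) (Submodule.inclusion_injective _)
    exact ⟨D.1, D.coe_le_socle.trans (socle_le C), ⟨r, le_rfl,
      exists_irredundant_generators r D.1 hD⟩, D.degree_deg⟩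
  -- A subcode `D` with `j ≥ r` irredundant generators has a socle of length at least `r`. The flat
  -- closure of that socle has the same support bound, and contains a flat of rank exactly `r`, of
  -- degree at most `|σ(D)|`.
  have h2 : ∀ w ∈ {w : ℕ | ∃ D : Submodule R (Fin n → R), D ≤ C ∧
      (∃ j, r ≤ j ∧ HasMinimalGenerators D j) ∧ w = ∑ i, codeSupport σ D i},
      ∃ D : Flat hσ.toIsSupport C, D.rk = r ∧ D.deg.degree ≤ w := by
    rintro _ ⟨D, hDC, ⟨j, hj, s, rfl, hs, hmin⟩, rfl⟩
    have hcard := card_le_length_quotient hs hmin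
    rw [length_quotient_jacobson_eq D (hC.imp_left fun h v hv => h v (hDC hv)),
      ← coe_submoduleLength, Nat.cast_le] at hcard
    have hle : socle D ≤ (Flat.mk hσ.toIsSupport C (codeSupport σ (socle D))).1 :=
      fun v hv => ⟨socle_mono hDC hv, le_codeSupport hv⟩
    obtain ⟨D', hD', hr'⟩ := Flat.exists_le_rk_eq hσ r _
      ((hj.trans hcard).trans (submoduleLength_strictMono.monotone hle))
    refine ⟨D', hr', ?_⟩
    rw [Flat.degree_deg]
    exact Finset.sum_le_sum fun i _ =>
      ((Flat.le_mk_iff.1 hD').trans (codeSupport_mono (socle_le D))) i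
  obtain ⟨D0, -, hD0⟩ := Flat.exists_le_rk_eq hσ r (Flat.whole hσ.toIsSupport C)
    (M_eq_rk_whole hσ.toIsSupport hC ▸ hr)
  have hmem := Nat.sInf_mem ⟨_, h1 D0 hD0⟩
  refine ⟨?_, ?_⟩
  · obtain ⟨D, hD, hle⟩ := h2 _ hmem
    exact ⟨D, hD, by exact_mod_cast le_antisymm hle (Nat.sInf_le (h1 D hD))⟩
  · rintro _ ⟨D, hD, rfl⟩
    exact_mod_cast Nat.sInf_le (h1 D hD)

variable (K : Type*) [Field K]

/-- The minimal graded free resolution of `S/I_C` given by the flats of `C`. -/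
def codeResolution (hσ : IsModularSupport σ) (C : Submodule R (Fin n → R)) :
    MinimalGradedFreeResolution (codeIdeal K σ C) :=
  posetResolution K (Flat.isCogeometricRank hσ C) Flat.deg Flat.deg_strictMono
    Flat.deg_bot (fun a => Flat.mk hσ.toIsSupport C a) (fun _ _ => Flat.deg_le_iff)
    (codeIdeal K σ C) (mem_codeIdeal_iff_flat hσ.toIsSupport C)

variable {K}

theorem range_shift_eq_deg_flats (hσ : IsModularSupport σ)
    (F : MinimalGradedFreeResolution (codeIdeal K σ C)) (r : ℕ) :
    Set.range (F.shift r) =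
      {t : ℤ | ∃ D : Flat hσ.toIsSupport C, D.rk = r ∧ (D.deg.degree : ℤ) = t} :=
  (F.range_shift_eq (degreePart_mem_codeIdeal C) (codeResolution K hσ C) r).trans
    (range_shift_posetResolution K _ _ _ _ _ _ _ _ r)

theorem isLeast_range_shift (hσ : IsModularSupport σ)
    (hC : (∀ v ∈ C, ∀ r ∈ Ring.jacobson R, r • v = 0) ∨ IsPrincipalIdealRing R)
    (F : MinimalGradedFreeResolution (codeIdeal K σ C)) (r : ℕ) (hr : r ≤ M C) :
    IsLeast (Set.range (F.shift r)) (generalizedWeight σ C r : ℤ) := by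
  rw [range_shift_eq_deg_flats hσ]
  exact isLeast_generalizedWeight hσ hC r hr

theorem le_M_of_mem_range_shift (hσ : IsModularSupport σ)
    (hC : (∀ v ∈ C, ∀ r ∈ Ring.jacobson R, r • v = 0) ∨ IsPrincipalIdealRing R)
    (F : MinimalGradedFreeResolution (codeIdeal K σ C)) {r : ℕ} {t : ℤ}
    (ht : t ∈ Set.range (F.shift r)) : r ≤ M C := by
  rw [range_shift_eq_deg_flats hσ] at ht
  obtain ⟨D, rfl, -⟩ := ht
  rw [M_eq_rk_whole hσ.toIsSupport hC]
  exact Flat.rk_strictMono.monotone D.le_whole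

/-- The rank of the whole socle, `M C`, is the largest rank of a flat, so the term in degree `M C`
is nonzero and the next one vanishes. -/
theorem projectiveDimension_quotient_codeIdeal (hσ : IsModularSupport σ)
    (hC : (∀ v ∈ C, ∀ r ∈ Ring.jacobson R, r • v = 0) ∨ IsPrincipalIdealRing R) :
    CategoryTheory.projectiveDimension (ModuleCat.of (MvPolynomial (Fin u) K)
      (MvPolynomial (Fin u) K ⧸ codeIdeal K σ C)) = ((M C : ℕ∞) : WithBot ℕ∞) := by
  refine (codeResolution K hσ C).projectiveDimension_eq (M C) (fun h0 => ?_) ?_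
  · obtain ⟨k, -⟩ := (isLeast_range_shift hσ hC (codeResolution K hσ C) (M C) le_rfl).1
    rw [h0] at k
    exact k.elim0
  · by_contra h0
    have := le_M_of_mem_range_shift hσ hC (codeResolution K hσ C) (r := M C + 1)
      ⟨⟨0, Nat.pos_of_ne_zero h0⟩, rfl⟩
    omega

end Weights

end

end ModularCode

theorem theorem4p3 {R : Type*} [CommRing R] [Nontrivial R] [Finite R] {K : Type*} [Field K]
    {n u : ℕ} (σ : (Fin n → R) → (Fin u → ℕ)) (hσ : ModularCode.IsModularSupport σ)
    (C : Submodule R (Fin n → R))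
    (hC : (∀ v ∈ C, ∀ r ∈ Ring.jacobson R, r • v = 0) ∨ IsPrincipalIdealRing R) :
    -- the projective dimension
    CategoryTheory.projectiveDimension (ModuleCat.of (MvPolynomial (Fin u) K)
        (MvPolynomial (Fin u) K ⧸ ModularCode.codeIdeal K σ C)) =
      ((ModularCode.M C : ℕ∞) : WithBot ℕ∞) ∧
    Nonempty (ModularCode.MinimalGradedFreeResolution (ModularCode.codeIdeal K σ C)) ∧
    ∀ F : ModularCode.MinimalGradedFreeResolution (ModularCode.codeIdeal K σ C),
      -- the minimum shift, that is the minimum degree of a nonzero element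
      (∀ r : ℕ, 1 ≤ r → r ≤ ModularCode.M C →
        IsLeast (Set.range (F.shift r)) (ModularCode.generalizedWeight σ C r : ℤ) ∧
        IsLeast {t : ℤ | ∃ x : Fin (F.rank r) → MvPolynomial (Fin u) K,
          x ≠ 0 ∧ ModularCode.IsHomogeneousVec (F.shift r) t x}
          (ModularCode.generalizedWeight σ C r : ℤ)) ∧
      -- the graded Betti numbers determine `M C` and the generalized weights
      IsGreatest {i : ℕ | ∃ j : ℤ, F.betti i j ≠ 0} (ModularCode.M C) ∧
      (∀ r : ℕ, 1 ≤ r → r ≤ ModularCode.M C →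
        IsLeast {j : ℤ | F.betti r j ≠ 0} (ModularCode.generalizedWeight σ C r : ℤ)) := by
  refine ⟨ModularCode.projectiveDimension_quotient_codeIdeal hσ hC,
    ⟨ModularCode.codeResolution K hσ C⟩, fun F => ?_⟩
  -- This also holds for `r = 0`, which the Betti number statement needs when `M C = 0`.
  have hleast := ModularCode.isLeast_range_shift hσ hC F
  refine ⟨fun r _ hr => ⟨hleast r hr, ModularCode.isLeast_degree_of_isLeast_shift (hleast r hr)⟩,
    ⟨⟨_, (F.betti_ne_zero_iff _ _).2 (hleast _ le_rfl).1⟩, ?_⟩, fun r _ hr => ?_⟩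
  · rintro i ⟨j, hj⟩
    exact ModularCode.le_M_of_mem_range_shift hσ hC F ((F.betti_ne_zero_iff i j).1 hj)
  · simp only [F.betti_ne_zero_iff]
    exact hleast r hr
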